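/- **Setting.** Let $L,R,\rho_s,h,\rho_f,C_0,C_1>0$, $\kappa=\rho_s h/\rho_f$, $\Omega=(0,L)\times(0,R)$ with coordinates $(z,r)$, $\Gamma=(0,L)\times\{R\}$, $\Gamma_b=(0,L)\times\{0\}$, $\Gamma_{in}=\{0\}\times(0,R)$, $\Gamma_{out}=\{L\}\times(0,R)$, $Q=\{q\in H^1(\Omega): q=0 \text{ on }\Gamma_{in}\cup\Gamma_{out}\}$, and $a_S(\eta,\xi)=\int_0^L (C_0\eta\xi+C_1\eta'\xi')$ on $H^1_0(0,L)$. The test problem couples an inviscid incompressible Stokes flow in the fixed domain $\Omega$ to the generalized string $\rho_s h\,\partial_t^2\eta+C_0\eta-C_1\partial_z^2\eta=p|_\Gamma$, $\eta(0)=\eta(L)=0$, with $u\cdot e_r=\partial_t\eta$ on $\Gamma$, $u\cdot n=0$ on $\Gamma_b$ and $p=p_{in/out}(t)$ on $\Gamma_{in/out}$, where $p_{in/out}(t)\in H^{1/2}(\Gamma_{in/out})$ for $t\ge 0$. Here $H^{1/2}(\Gamma_{in/out})$ carries the quotient norm of $H^1(\Omega)$. All boundary value problems are understood weakly. **The scheme.**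 Let $\beta\in[0,1]$, $\theta\in[0,1/2]$, $\Delta t>0$, $t^n=n\Delta t$. Given $p^0\in H^1(\Omega)$ and $\eta^0,\eta^1\in H^1_0(0,L)$, the kinematically coupled $\beta$-scheme in pressure formulation, with the structure step discretized by the $\theta$-scheme, computes * (fluid, $n\ge0$) $p^{n+1}\in H^1(\Omega)$ with $-\Delta p^{n+1}=0$ in $\Omega$, $p^{n+1}=p_{in/out}(t^{n+1})$ on $\Gamma_{in/out}$, $\partial_n p^{n+1}=0$ on $\Gamma_b$, $p^{n+1}+\kappa\,\partial_n p^{n+1}=\beta p^n$ on $\Gamma$; * (structure, $n\ge1$) $\eta^{n+1}\in H_0^1(0,L)$ with, for all $\xi\in H^1_0(0,L)$, $$\tfrac{\rho_s h}{\Delta t^2}\int_0^L(\eta^{n+1}-2\eta^n+\eta^{n-1})\xi+a_S(\theta\eta^{n+1}+(1-2\theta)\eta^n+\theta\eta^{n-1},\xi)=\beta\int_\Gamma p^{n+1}\xi .$$ For $w\in L^2(\Gamma)$ let $\mathcal Pw\in Q$ solve $-\Delta \mathcal Pw=0$, $\partial_n\mathcal Pw=0$ on $\Gamma_b$, $\mathcal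 Pw+\kappa\,\partial_n\mathcal Pw=w$ on $\Gamma$, and let $\mathcal Rw\in Q$ solve $-\Delta\mathcal Rw=0$, $\partial_n\mathcal Rw=0$ on $\Gamma_b$, $\partial_n\mathcal Rw=w$ on $\Gamma$. Set $\mathcal Sw=\mathcal Pw|_\Gamma$ and $\mathcal M_Aw=\mathcal Rw|_\Gamma$ (the added-mass operator). Let $p_{ext}^{n+1}$ be the trace on $\Gamma$ of the solution of the fluid step with datum $0$ instead of $\beta p^n$ on $\Gamma$. **Theorem.** For all such $L,R,\rho_s,h,\rho_f,C_0,C_1$: 1. The Robin problem of the fluid step (for any data in $H^{1/2}(\Gamma_{in/out})$ and $L^2(\Gamma)$) and the problem for $\mathcal R$ are uniquely solvable. For all $\beta\in[0,1]$, $\theta\in(0,1/2]$ and $\Delta t>0$ the coupled scheme has exactly one solution for given data. 2. $\mathcal S$ and $\mathcal M_A$ are bounded operators on $L^2(\Gamma)$. The functions $z_i=\sqrt{2/L}\,\sin(i\pi z/L)$, $i\ge1$, form an orthonormal basis of $L^2(\Gamma)$, and $\mathcal M_Az_i=\mu_iz_i$, $\mathcal Sz_i=\lambda_iz_i$ with $$\mu_i=\frac{L}{i\pi\tanh(i\pi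 R/L)},\qquad \lambda_i=\frac{\mu_i}{\mu_i+\rho_s h/\rho_f}.$$ The eigenvalues of $\mathcal M_A$ are exactly the $\mu_i$; $\lambda$ is an eigenvalue of $\mathcal S$ if and only if $\lambda=\mu/(\mu+\rho_sh/\rho_f)$ for an eigenvalue $\mu$ of $\mathcal M_A$; every eigenvalue of $\mathcal S$ satisfies $0<\lambda\le\lambda_1<1$. 3. For every $\beta\in[0,1]$, $\Delta t>0$ and $n\ge0$, $p^{n+1}|_\Gamma=p_{ext}^{n+1}+\mathcal S(\beta p^n|_\Gamma)$. With $(\cdot)_j$ the coefficient along $z_j$, the load on the $j$-th mode is $$\beta (p^{n+1})_j=\sum_{i=0}^{n}\beta^{i+1}\lambda_j^i(p_{ext}^{n+1-i})_j+\beta^{n+2}\lambda_j^{n+1}(p^0)_j .$$ The series $\sum_i\beta^{i+1}\lambda_j^ib_i$ converges absolutely for every bounded sequence $(b_i)$. If $(p_{ext}^n)_j\to c$ as $n\to\infty$, then $\beta(p^n)_j\to\sum_{i\ge0}\beta^{i+1}\lambda_j^i c$. The coefficients $y_n=(\eta^n)_j$ of a solution satisfy the modal $\theta$-scheme $$\rho_sh\,\frac{y_{n+1}-2y_n+y_{n-1}}{\Delta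 t^2}+\ell_j(\theta y_{n+1}+(1-2\theta)y_n+\theta y_{n-1})=\beta(p^{n+1})_j,\qquad \ell_j=C_0+C_1(j\pi/L)^2 .$$ 4. (Unconditional stability.) There is a constant $C>0$, depending only on $L,R,\rho_s,h,\rho_f,C_0,C_1$, such that for all $\beta\in[0,1]$, all $\Delta t>0$, all inlet and outlet pressures with $\|p_{in/out}(t)\|_{H^{1/2}}\le M$ for $t\ge0$, and all $p^0$, the following hold. * For all $n\ge1$, both $\|p^n\|_{H^1(\Omega)}$ and $\|p^n\|_{L^2(\Gamma)}$ are at most $C(\|p^0\|_{L^2(\Gamma)}+M)$. * For all $\theta\in[1/4,1/2]$, all $\eta^0,\eta^1$ and all $n\ge0$, the energy $E^n=\rho_sh\big\|\tfrac{\eta^{n+1}-\eta^n}{\Delta t}\big\|^2_{L^2}+\big\|\tfrac{\eta^{n+1}+\eta^n}2\big\|_S^2+(\theta-\tfrac14)\|\eta^{n+1}-\eta^n\|_S^2$, where $\|\xi\|_S^2=a_S(\xi,\xi)$, satisfies $$\sqrt{E^n}\le\sqrt{E^0}+C\big(\Delta t\,\|p^0\|_{L^2(\Gamma)}+n\Delta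 t\,M\big).$$ If $p_{in}$ and $p_{out}$ do not depend on $t\ge 0$, then also $\sqrt{E^n}\le\sqrt{E^0}+C\big(\Delta t\,\|p^0\|_{L^2(\Gamma)}+(1+\Delta t)M\big)$ for all $n\ge0$. * For all $\theta\in[0,1/2]$ and all modes $j$ with $\sigma:=1-\frac{(1-4\theta)\ell_j\Delta t^2}{4\rho_sh}>0$ (automatic if $\theta\ge1/4$), every solution $y$ of the modal $\theta$-scheme has energy $E_j^n=\rho_sh\big(\tfrac{y_{n+1}-y_n}{\Delta t}\big)^2+\ell_j\big(\tfrac{y_{n+1}+y_n}2\big)^2+(\theta-\tfrac14)\ell_j(y_{n+1}-y_n)^2\ge0$ with $$\sqrt{E_j^n}\le\sqrt{E_j^0}+\tfrac{C}{\sqrt{\sigma}}\big(\Delta t\,\|p^0\|_{L^2(\Gamma)}+n\Delta t\,M\big),\qquad n\ge0 .$$ -/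

import Mathlib

open MeasureTheory Set Filter Topology
open scoped ContDiff

noncomputable section

/-- Data of the test problem: an inviscid incompressible fluid in the fixed rectangle
`Ω = (0,L) × (0,R)` (coordinates `(z,r)`), whose top side `Γ = (0,L) × {R}` is a generalized string
`ρs h ∂ₜ²η + C₀ η - C₁ ∂_z²η = p|_Γ`, `η(0) = η(L) = 0`. -/
structure TestProblem where
  L : ℝ
  R : ℝ
  ρs : ℝ
  h : ℝ
  ρf : ℝ
  C₀ : ℝ
  C₁ : ℝ
  L_pos : 0 < L
  R_pos : 0 < R
  ρs_pos : 0 < ρs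
  h_pos : 0 < h
  ρf_pos : 0 < ρf
  C₀_pos : 0 < C₀
  C₁_pos : 0 < C₁

/-- The Robin parameter `ρs h / ρf`. -/
def TestProblem.κ (P : TestProblem) : ℝ := P.ρs * P.h / P.ρf

/-- The open rectangle `(0,L) × (0,R)`. -/
def rect (L R : ℝ) : Set (ℝ × ℝ) := Ioo 0 L ×ˢ Ioo 0 R

/-- `L²(0,a)`. Functions on `Γ` and on the bottom side are elements of `L2Interval L` (variable `z`),
functions on the inlet and on the outlet are elements of `L2Interval R` (variable `r`). -/
abbrev L2Interval (a : ℝ) : Type := Lp ℝ 2 (volume.restrict (Ioo (0 : ℝ) a))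

/-- `L²((0,L) × (0,R))`. -/
abbrev L2Rect (L R : ℝ) : Type := Lp ℝ 2 (volume.restrict (rect L R))

/-- A function of `H¹((0,L) × (0,R))`, carried together with its weak partial derivatives and its
traces on the four sides. Green's formula against `φ ∈ C^∞` with support inside the rectangle says
that `dz`, `dr` are the weak derivatives, and against general `φ ∈ C^∞(ℝ²)` that `trIn`, `trOut`,
`trBot`, `trTop` are the traces on `z = 0`, `z = L`, `r = 0`, `r = R`. All the other fields are
determined by `val`, and every `H¹` function of a rectangle has such traces. -/
@[ext]
structure H1Rect (L R : ℝ) where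
  val : L2Rect L R
  dz : L2Rect L R
  dr : L2Rect L R
  trIn : L2Interval R
  trOut : L2Interval R
  trBot : L2Interval L
  trTop : L2Interval L
  green_z : ∀ φ : ℝ × ℝ → ℝ, ContDiff ℝ ∞ φ →
    ∫ x in rect L R, val x * fderiv ℝ φ x (1, 0) =
      - (∫ x in rect L R, dz x * φ x)
      + ((∫ r in Ioo 0 R, trOut r * φ (L, r)) - ∫ r in Ioo 0 R, trIn r * φ (0, r))
  green_r : ∀ φ : ℝ × ℝ → ℝ, ContDiff ℝ ∞ φ →
    ∫ x in rect L R, val x * fderiv ℝ φ x (0, 1) =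
      - (∫ x in rect L R, dr x * φ x)
      + ((∫ z in Ioo 0 L, trTop z * φ (z, R)) - ∫ z in Ioo 0 L, trBot z * φ (z, 0))

/-- The `H¹(Ω)` norm. -/
def H1Rect.h1norm {L R : ℝ} (q : H1Rect L R) : ℝ :=
  Real.sqrt (‖q.val‖ ^ 2 + ‖q.dz‖ ^ 2 + ‖q.dr‖ ^ 2)

/-- A function of `H¹₀(0,L)` with its weak derivative `dx`: since the test functions need not vanish
at the end points, the formula also says that `val` vanishes at `0` and at `L`. -/
@[ext]
structure H10 (L : ℝ) where
  val : L2Interval L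
  dx : L2Interval L
  green : ∀ φ : ℝ → ℝ, ContDiff ℝ ∞ φ →
    ∫ x in Ioo 0 L, val x * deriv φ x = - ∫ x in Ioo 0 L, dx x * φ x

/-- Weak solution `u ∈ H¹(Ω)` of
`-Δu = 0` in `Ω`, `u = gIn / gOut` on the inlet / outlet, `∂ₙu = 0` on the bottom,
`u + κ ∂ₙu = w` on `Γ`. The test functions range over
`Q = {φ ∈ H¹(Ω) : φ = 0 on inlet and outlet}`. -/
def IsRobinSolution {L R : ℝ} (κ : ℝ) (gIn gOut : L2Interval R) (w : L2Interval L)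
    (u : H1Rect L R) : Prop :=
  u.trIn = gIn ∧ u.trOut = gOut ∧
  ∀ φ : H1Rect L R, φ.trIn = 0 → φ.trOut = 0 →
    inner ℝ u.dz φ.dz + inner ℝ u.dr φ.dr + κ⁻¹ * inner ℝ u.trTop φ.trTop
      = κ⁻¹ * inner ℝ w φ.trTop

/-- Weak solution `u ∈ Q` of `-Δu = 0` in `Ω`, `u = 0` on inlet and outlet, `∂ₙu = 0` on the bottom,
`∂ₙu = w` on `Γ`. -/
def IsNeumannSolution {L R : ℝ} (w : L2Interval L) (u : H1Rect L R) : Prop :=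
  u.trIn = 0 ∧ u.trOut = 0 ∧
  ∀ φ : H1Rect L R, φ.trIn = 0 → φ.trOut = 0 →
    inner ℝ u.dz φ.dz + inner ℝ u.dr φ.dr = inner ℝ w φ.trTop

/-- `S` is the Robin-to-Dirichlet trace operator on `L²(Γ)`: `S w = (𝒫 w)|_Γ`, with `𝒫 w` the solution
of the Robin problem with data `w` on `Γ` and zero inlet and outlet pressure. -/
def IsRobinTraceOperator (P : TestProblem) (S : L2Interval P.L →L[ℝ] L2Interval P.L) : Prop :=
  ∀ w, ∃ u : H1Rect P.L P.R, IsRobinSolution P.κ 0 0 w u ∧ S w = u.trTop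

/-- `M` is the added-mass (Neumann-to-Dirichlet) operator on `L²(Γ)`: `M w = (ℛ w)|_Γ`. -/
def IsAddedMassOperator (P : TestProblem) (M : L2Interval P.L →L[ℝ] L2Interval P.L) : Prop :=
  ∀ w, ∃ u : H1Rect P.L P.R, IsNeumannSolution w u ∧ M w = u.trTop

/-- `μ_i = L / (iπ tanh (iπR/L))`, with `i = j + 1`. -/
def TestProblem.μ (P : TestProblem) (j : ℕ) : ℝ :=
  P.L / (((j : ℝ) + 1) * Real.pi * Real.tanh (((j : ℝ) + 1) * Real.pi * P.R / P.L))

/-- `λ_i = μ_i / (μ_i + ρs h / ρf)`, with `i = j + 1`. -/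
def TestProblem.lam (P : TestProblem) (j : ℕ) : ℝ := P.μ j / (P.μ j + P.κ)

/-- Eigenvalue of the string operator `ℒ = C₀ - C₁ ∂_z²` for the mode `sin (iπz/L)`, `i = j + 1`. -/
def TestProblem.ell (P : TestProblem) (j : ℕ) : ℝ :=
  P.C₀ + P.C₁ * (((j : ℝ) + 1) * Real.pi / P.L) ^ 2

/-- `(gIn, gOut)` belongs to the trace space `H^{1/2}` of the inlet and outlet, with (quotient) norm
at most `M`. -/
def InOutNormLE (L R : ℝ) (gIn gOut : L2Interval R) (M : ℝ) : Prop :=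
  ∃ q : H1Rect L R, q.trIn = gIn ∧ q.trOut = gOut ∧ q.h1norm ≤ M

/-- Fluid sub-problem of the `β`-scheme with time step `dt`: `p^{n+1}` solves the Robin problem with
inlet and outlet pressures taken at `t^{n+1} = (n+1) dt` and with data `β p^n` on `Γ`. -/
def FluidSteps (P : TestProblem) (β dt : ℝ) (pIn pOut : ℝ → L2Interval P.R)
    (p : ℕ → H1Rect P.L P.R) : Prop :=
  ∀ n : ℕ, IsRobinSolution P.κ (pIn (((n : ℝ) + 1) * dt)) (pOut (((n : ℝ) + 1) * dt))
    (β • (p n).trTop) (p (n + 1))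

/-- The external pressures: `q^{n+1}` solves the fluid sub-problem with the same inlet and outlet
pressures and with zero data on `Γ`; then `p_ext^{n+1} = q^{n+1}|_Γ`. The value `q 0` plays no role. -/
def ExternalPressure (P : TestProblem) (dt : ℝ) (pIn pOut : ℝ → L2Interval P.R)
    (q : ℕ → H1Rect P.L P.R) : Prop :=
  ∀ n : ℕ, IsRobinSolution P.κ (pIn (((n : ℝ) + 1) * dt)) (pOut (((n : ℝ) + 1) * dt))
    0 (q (n + 1))

/-- Structure sub-problem of the `β`-scheme, discretized by the `θ`-scheme and written weakly in
`H¹₀(0,L)`: for all `n ≥ 1`,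
`ρs h (η^{n+1} - 2η^n + η^{n-1}) / dt² + ℒ (θ η^{n+1} + (1-2θ) η^n + θ η^{n-1}) = β p^{n+1}|_Γ`. -/
def StructureSteps (P : TestProblem) (β θ dt : ℝ) (p : ℕ → H1Rect P.L P.R)
    (η : ℕ → H10 P.L) : Prop :=
  ∀ (n : ℕ) (ξ : H10 P.L),
    P.ρs * P.h / dt ^ 2 *
        inner ℝ ((η (n + 2)).val - (2 : ℝ) • (η (n + 1)).val + (η n).val) ξ.val
      + (P.C₀ * inner ℝ
            (θ • (η (n + 2)).val + (1 - 2 * θ) • (η (n + 1)).val + θ • (η n).val) ξ.val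
        + P.C₁ * inner ℝ
            (θ • (η (n + 2)).dx + (1 - 2 * θ) • (η (n + 1)).dx + θ • (η n).dx) ξ.dx)
      = β * inner ℝ (p (n + 2)).trTop ξ.val

/-- The `θ`-scheme for one Fourier coefficient: string eigenvalue `l`, load `f^{n+1}`. -/
def ModalSteps (P : TestProblem) (θ dt l : ℝ) (f y : ℕ → ℝ) : Prop :=
  ∀ n : ℕ, P.ρs * P.h * ((y (n + 2) - 2 * y (n + 1) + y n) / dt ^ 2)
      + l * (θ * y (n + 2) + (1 - 2 * θ) * y (n + 1) + θ * y n) = f (n + 2)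

/-- Discrete energy of the `θ`-scheme for two consecutive displacements `a`, `b`:
`ρs h ‖(b - a)/dt‖² + ‖(a + b)/2‖²_S + (θ - 1/4) ‖b - a‖²_S`, where
`‖ξ‖²_S = C₀ ‖ξ‖² + C₁ ‖∂_z ξ‖²` is the elastic energy. -/
def energy (P : TestProblem) (θ dt : ℝ) (a b : H10 P.L) : ℝ :=
  P.ρs * P.h * ‖dt⁻¹ • (b.val - a.val)‖ ^ 2
    + (P.C₀ * ‖(1 / 2 : ℝ) • (a.val + b.val)‖ ^ 2 + P.C₁ * ‖(1 / 2 : ℝ) • (a.dx + b.dx)‖ ^ 2)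
    + (θ - 1 / 4) * (P.C₀ * ‖b.val - a.val‖ ^ 2 + P.C₁ * ‖b.dx - a.dx‖ ^ 2)

/-- Discrete energy of the `θ`-scheme for one Fourier coefficient. -/
def modalEnergy (P : TestProblem) (θ dt l : ℝ) (a b : ℝ) : ℝ :=
  P.ρs * P.h * ((b - a) / dt) ^ 2 + l * ((a + b) / 2) ^ 2 + (θ - 1 / 4) * (l * (b - a) ^ 2)

end

/-!
The function spaces are handled through Green's formulas only. Pairing with smooth functions
determines an `L²` function and its norm (`norm_le_of_inner_smooth_le`), so estimates for `H¹`
functions follow by duality from suitable test functions: the primitive in `z` of a smooth function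
gives the Poincaré inequality on `Q` (`H1Rect.norm_val_le`), and products of an affine function of
`r` with a function of `z` give the trace inequalities (`H1Rect.inner_trace_le`). On `Q` the
gradient therefore controls everything (`H1Rect.exists_gradient_bound`). Since `Q` is a closed
subspace of a product of `L²` spaces, the Lax–Milgram theorem solves the Robin and the Neumann
problems. The structure step is an elliptic problem on `H¹₀` and is solved in the same way.

The sines form a Hilbert basis because polynomials in `cos (πz/L)` approximate every continuous
function on `[0,L]` (`eq_zero_of_inner_sineLp`). Separation of variables,
`u = sin (kz) cosh (kr) / (k sinh (kR))`, diagonalizes the added-mass operator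
(`exists_isNeumannSolution_sineLp`), and a Neumann solution with data `w` solves the Robin problem
with data `u|_Γ + κ w`, which gives `λ = μ / (μ + κ)`. Both operators are symmetric, so there are
no other eigenvalues.

By linearity the pressure on `Γ` satisfies `p^{n+1} = p_ext^{n+1} + S (β p^n)`; its coefficients
solve a scalar linear recursion whose factor `β λ` is smaller than one. For the stability it matters
that the Robin trace operator contracts by a factor `ρ < 1` that depends on the test problem alone
(`exists_contraction_factor`): the initial pressure is forgotten geometrically and contributes only
a convergent series to the load. Testing the structure step with `η^{n+1} - η^{n-1}` gives the
energy balance `E^n - E^{n-1} = ⟨F, η^{n+1} - η^{n-1}⟩`, hence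
`√E^n ≤ √E^{n-1} + Δt ‖F‖ / √(ρₛh)`, which is summed over the time steps. For inlet and outlet
pressures constant in time the load converges geometrically; subtracting the static displacement
under the limit load leaves a summable load, so that the bound does not grow with `n`.
-/

noncomputable section

/-! ### Smooth functions in `L²` of a bounded set -/

theorem memLp_restrict_of_continuous {E : Type*} [NormedAddCommGroup E] [ProperSpace E]
    [MeasurableSpace E] [BorelSpace E] {μ : Measure E} [IsFiniteMeasureOnCompacts μ] {U : Set E}
    (hU : Bornology.IsBounded U) (hm : MeasurableSet U) {f : E → ℝ} (hf : Continuous f) :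
    MemLp f 2 (μ.restrict U) := by
  obtain ⟨C, hC⟩ := hU.isCompact_closure.exists_bound_of_continuousOn hf.continuousOn
  have : IsFiniteMeasure (μ.restrict U) := ⟨by simpa using hU.measure_lt_top⟩
  exact MemLp.of_bound hf.aestronglyMeasurable C
    (ae_restrict_of_forall_mem hm fun x hx => hC x (subset_closure hx))

theorem isBounded_rect (L R : ℝ) : Bornology.IsBounded (rect L R) :=
  (Metric.isBounded_Ioo 0 L).prod (Metric.isBounded_Ioo 0 R)

theorem measurableSet_rect (L R : ℝ) : MeasurableSet (rect L R) :=
  measurableSet_Ioo.prod measurableSet_Ioo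

/-- The class in `L²(0,a)` of a continuous function. -/
def L2Interval.ofCont (a : ℝ) (f : ℝ → ℝ) (hf : Continuous f) : L2Interval a :=
  (memLp_restrict_of_continuous (Metric.isBounded_Ioo 0 a) measurableSet_Ioo hf).toLp f

/-- The class in `L²((0,L) × (0,R))` of a continuous function. -/
def L2Rect.ofCont (L R : ℝ) (f : ℝ × ℝ → ℝ) (hf : Continuous f) : L2Rect L R :=
  (memLp_restrict_of_continuous (isBounded_rect L R) (measurableSet_rect L R) hf).toLp f

theorem inner_toLp_right {α : Type*} [MeasurableSpace α] {μ : Measure α} (f : Lp ℝ 2 μ)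
    {g : α → ℝ} (hg : MemLp g 2 μ) : inner ℝ f (hg.toLp g) = ∫ x, f x * g x ∂μ := by
  rw [L2.inner_def]
  refine integral_congr_ae ?_
  filter_upwards [hg.coeFn_toLp] with x hx
  simp [hx, mul_comm]

theorem L2Interval.ofCont_ae {a : ℝ} {f : ℝ → ℝ} (hf : Continuous f) :
    (L2Interval.ofCont a f hf : ℝ → ℝ) =ᵐ[volume.restrict (Ioo 0 a)] f :=
  MemLp.coeFn_toLp _

theorem L2Rect.ofCont_ae {L R : ℝ} {f : ℝ × ℝ → ℝ} (hf : Continuous f) :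
    (L2Rect.ofCont L R f hf : ℝ × ℝ → ℝ) =ᵐ[volume.restrict (rect L R)] f :=
  MemLp.coeFn_toLp _

theorem L2Interval.inner_ofCont {a : ℝ} (f : L2Interval a) {g : ℝ → ℝ} (hg : Continuous g) :
    inner ℝ f (L2Interval.ofCont a g hg) = ∫ x in Ioo 0 a, f x * g x :=
  inner_toLp_right f _

theorem L2Rect.inner_ofCont {L R : ℝ} (f : L2Rect L R) {g : ℝ × ℝ → ℝ} (hg : Continuous g) :
    inner ℝ f (L2Rect.ofCont L R g hg) = ∫ x in rect L R, f x * g x :=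
  inner_toLp_right f _

theorem L2Interval.inner_ofCont_ofCont {a : ℝ} {f g : ℝ → ℝ} (hf : Continuous f)
    (hg : Continuous g) :
    inner ℝ (L2Interval.ofCont a f hf) (L2Interval.ofCont a g hg) = ∫ x in Ioo 0 a, f x * g x := by
  rw [L2Interval.inner_ofCont]
  refine integral_congr_ae ?_
  filter_upwards [L2Interval.ofCont_ae (a := a) hf] with x hx
  rw [hx]

theorem L2Rect.inner_ofCont_ofCont {L R : ℝ} {f g : ℝ × ℝ → ℝ} (hf : Continuous f)
    (hg : Continuous g) :
    inner ℝ (L2Rect.ofCont L R f hf) (L2Rect.ofCont L R g hg) = ∫ x in rect L R, f x * g x := by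
  rw [L2Rect.inner_ofCont]
  refine integral_congr_ae ?_
  filter_upwards [L2Rect.ofCont_ae (L := L) (R := R) hf] with x hx
  rw [hx]

theorem L2Interval.norm_sq_ofCont {a : ℝ} {f : ℝ → ℝ} (hf : Continuous f) :
    ‖L2Interval.ofCont a f hf‖ ^ 2 = ∫ x in Ioo 0 a, f x ^ 2 := by
  rw [← real_inner_self_eq_norm_sq, L2Interval.inner_ofCont_ofCont]
  simp only [sq]

theorem L2Rect.norm_sq_ofCont {L R : ℝ} {f : ℝ × ℝ → ℝ} (hf : Continuous f) :
    ‖L2Rect.ofCont L R f hf‖ ^ 2 = ∫ x in rect L R, f x ^ 2 := by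
  rw [← real_inner_self_eq_norm_sq, L2Rect.inner_ofCont_ofCont]
  simp only [sq]

theorem integrableOn_rect {L R : ℝ} {f : ℝ × ℝ → ℝ} (hf : Continuous f) :
    IntegrableOn f (rect L R) := by
  have : IsFiniteMeasure (volume.restrict (rect L R)) :=
    ⟨by simpa using (isBounded_rect L R).measure_lt_top⟩
  exact (memLp_restrict_of_continuous (isBounded_rect L R) (measurableSet_rect L R) hf).integrable
    (by norm_num)

theorem integrableOn_Ioo_of_continuous {a : ℝ} {f : ℝ → ℝ} (hf : Continuous f) :
    IntegrableOn f (Ioo 0 a) :=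
  (hf.integrableOn_Icc (a := 0) (b := a)).mono_set Ioo_subset_Icc_self

/-- Duality: by density, the `L²` norm is controlled by pairings with smooth functions. -/
theorem norm_le_of_inner_smooth_le {E : Type*} [NormedAddCommGroup E] [NormedSpace ℝ E]
    [FiniteDimensional ℝ E] [MeasurableSpace E] [BorelSpace E] {μ : Measure E}
    [IsFiniteMeasureOnCompacts μ] (f : Lp ℝ 2 μ) {C : ℝ} (hC : 0 ≤ C)
    (h : ∀ g : E → ℝ, ContDiff ℝ ∞ g → HasCompactSupport g → ∀ hg : MemLp g 2 μ,
      inner ℝ f (hg.toLp g) ≤ C * ‖hg.toLp g‖) : ‖f‖ ≤ C := by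
  have hcl : IsClosed {g : Lp ℝ 2 μ | inner ℝ f g ≤ C * ‖g‖} :=
    isClosed_le (by fun_prop) (by fun_prop)
  have hall : ∀ g : Lp ℝ 2 μ, inner ℝ f g ≤ C * ‖g‖ := by
    intro g
    refine hcl.closure_subset_iff.2 ?_
      (Lp.dense_hasCompactSupport_contDiff (F := ℝ) (μ := μ) (p := 2) (by norm_num) g)
    rintro k ⟨g, hkg, hsupp, hg⟩
    have hm : MemLp g 2 μ := (memLp_congr_ae hkg).1 (Lp.memLp k)
    have : k = hm.toLp g := by
      apply Lp.ext
      exact hkg.trans hm.coeFn_toLp.symm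
    rw [this]
    exact h g hg hsupp hm
  have := hall f
  rw [real_inner_self_eq_norm_sq, sq] at this
  by_contra hlt
  push Not at hlt
  nlinarith [norm_nonneg f]

theorem L2Interval.norm_le_of_inner_le {a : ℝ} (f : L2Interval a) {C : ℝ} (hC : 0 ≤ C)
    (h : ∀ (g : ℝ → ℝ) (hg : ContDiff ℝ ∞ g),
      inner ℝ f (L2Interval.ofCont a g hg.continuous) ≤
        C * ‖L2Interval.ofCont a g hg.continuous‖) : ‖f‖ ≤ C :=
  norm_le_of_inner_smooth_le f hC fun g hg _ _ => h g hg

theorem L2Rect.norm_le_of_inner_le {L R : ℝ} (f : L2Rect L R) {C : ℝ} (hC : 0 ≤ C)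
    (h : ∀ (g : ℝ × ℝ → ℝ) (hg : ContDiff ℝ ∞ g), HasCompactSupport g →
      inner ℝ f (L2Rect.ofCont L R g hg.continuous) ≤
        C * ‖L2Rect.ofCont L R g hg.continuous‖) : ‖f‖ ≤ C :=
  norm_le_of_inner_smooth_le f hC fun g hg hs _ => h g hg hs

/-! ### Green's formula for smooth functions on the rectangle -/

theorem continuous_fderiv_apply {E : Type*} [NormedAddCommGroup E] [NormedSpace ℝ E] {F : E → ℝ}
    (hF : ContDiff ℝ ∞ F) (v : E) : Continuous fun x => fderiv ℝ F x v :=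
  (hF.continuous_fderiv (by simp)).clm_apply continuous_const

theorem contDiff_fderiv_apply {E : Type*} [NormedAddCommGroup E] [NormedSpace ℝ E] {F : E → ℝ}
    (hF : ContDiff ℝ ∞ F) (v : E) : ContDiff ℝ ∞ fun x => fderiv ℝ F x v :=
  (hF.fderiv_right (m := ∞) (by simp)).clm_apply contDiff_const

theorem hasDerivAt_fst {F : ℝ × ℝ → ℝ} (hF : ContDiff ℝ ∞ F) (z r : ℝ) :
    HasDerivAt (fun s => F (s, r)) (fderiv ℝ F (z, r) (1, 0)) z :=
  ((hF.differentiable (by simp)) (z, r)).hasFDerivAt.comp_hasDerivAt z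
    ((hasDerivAt_id z).prodMk (hasDerivAt_const z r))

theorem hasDerivAt_snd {F : ℝ × ℝ → ℝ} (hF : ContDiff ℝ ∞ F) (z r : ℝ) :
    HasDerivAt (fun s => F (z, s)) (fderiv ℝ F (z, r) (0, 1)) r :=
  ((hF.differentiable (by simp)) (z, r)).hasFDerivAt.comp_hasDerivAt r
    ((hasDerivAt_const r z).prodMk (hasDerivAt_id r))

theorem integral_Ioo_of_hasDerivAt {a : ℝ} (ha : 0 < a) {f f' : ℝ → ℝ}
    (h : ∀ x, HasDerivAt f (f' x) x) (hf' : Continuous f') :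
    ∫ x in Ioo 0 a, f' x = f a - f 0 := by
  rw [← integral_Ioc_eq_integral_Ioo, ← intervalIntegral.integral_of_le ha.le]
  exact intervalIntegral.integral_eq_sub_of_hasDerivAt (fun x _ => h x)
    (hf'.intervalIntegrable _ _)

theorem integral_rect_fderiv_fst {L R : ℝ} (hL : 0 < L) {F : ℝ × ℝ → ℝ} (hF : ContDiff ℝ ∞ F) :
    ∫ x in rect L R, fderiv ℝ F x (1, 0) =
      (∫ r in Ioo 0 R, F (L, r)) - ∫ r in Ioo 0 R, F (0, r) := by
  have hc := continuous_fderiv_apply hF (1, 0)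
  have hint := integrableOn_rect (L := L) (R := R) hc
  have hcF := hF.continuous
  rw [IntegrableOn, rect, Measure.volume_eq_prod, ← Measure.prod_restrict] at hint
  rw [rect, Measure.volume_eq_prod, ← Measure.prod_restrict, integral_prod_symm _ hint,
    ← integral_sub]
  · refine integral_congr_ae (ae_of_all _ fun r => ?_)
    exact integral_Ioo_of_hasDerivAt hL (fun z => hasDerivAt_fst hF z r)
      (hc.comp (by fun_prop))
  · exact integrableOn_Ioo_of_continuous (by fun_prop)
  · exact integrableOn_Ioo_of_continuous (by fun_prop)

theorem integral_rect_fderiv_snd {L R : ℝ} (hR : 0 < R) {F : ℝ × ℝ → ℝ} (hF : ContDiff ℝ ∞ F) :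
    ∫ x in rect L R, fderiv ℝ F x (0, 1) =
      (∫ z in Ioo 0 L, F (z, R)) - ∫ z in Ioo 0 L, F (z, 0) := by
  have hc := continuous_fderiv_apply hF (0, 1)
  have hint := integrableOn_rect (L := L) (R := R) hc
  have hcF := hF.continuous
  rw [IntegrableOn, rect, Measure.volume_eq_prod, ← Measure.prod_restrict] at hint
  rw [rect, Measure.volume_eq_prod, ← Measure.prod_restrict, integral_prod _ hint,
    ← integral_sub]
  · refine integral_congr_ae (ae_of_all _ fun z => ?_)
    exact integral_Ioo_of_hasDerivAt hR (fun r => hasDerivAt_snd hF z r)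
      (hc.comp (by fun_prop))
  · exact integrableOn_Ioo_of_continuous (by fun_prop)
  · exact integrableOn_Ioo_of_continuous (by fun_prop)

theorem fderiv_mul_apply {E : Type*} [NormedAddCommGroup E] [NormedSpace ℝ E] {u φ : E → ℝ}
    (hu : ContDiff ℝ ∞ u) (hφ : ContDiff ℝ ∞ φ) (x v : E) :
    fderiv ℝ (fun y => u y * φ y) x v = u x * fderiv ℝ φ x v + fderiv ℝ u x v * φ x := by
  rw [fderiv_fun_mul (hu.differentiable (by simp) x) (hφ.differentiable (by simp) x)]
  simp [mul_comm]

/-! ### The Poincaré inequality in the axial direction -/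

/-- Smooth primitives in `z`. Smoothness in both variables comes from writing the primitive as a
convolution with the Heaviside function, with `r` as a parameter. -/
theorem exists_primitive_fst {ψ : ℝ × ℝ → ℝ} (hψ : ContDiff ℝ ∞ ψ) (hs : HasCompactSupport ψ) :
    ∃ φ : ℝ × ℝ → ℝ, ContDiff ℝ ∞ φ ∧ (∀ x, fderiv ℝ φ x (1, 0) = ψ x) ∧ ∀ r, φ (0, r) = 0 := by
  have hψc := hψ.continuous
  let H : ℝ → ℝ := (Ici (0 : ℝ)).indicator fun _ => 1
  have hH : LocallyIntegrable H volume :=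
    (locallyIntegrable_const (1 : ℝ)).indicator measurableSet_Ici
  let g : ℝ → ℝ → ℝ := fun r t => ψ (t, r)
  let k : Set ℝ := Prod.fst '' tsupport ψ
  have hk : IsCompact k := hs.isCompact.image continuous_fst
  have hgk : ∀ r t, t ∉ k → g r t = 0 := by
    intro r t ht
    by_contra hne
    exact ht ⟨(t, r), subset_tsupport ψ hne, rfl⟩
  have hsm : ContDiffOn ℝ ∞
      (fun q : ℝ × ℝ => convolution H (g q.1) (ContinuousLinearMap.mul ℝ ℝ) volume q.2)
      (univ ×ˢ univ) := by
    refine contDiffOn_convolution_right_with_param (n := ⊤) _ isOpen_univ hk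
      (fun p x _ hx => hgk p x hx) hH ?_
    exact (hψ.comp (contDiff_snd.prodMk contDiff_fst)).contDiffOn
  rw [univ_prod_univ, contDiffOn_univ] at hsm
  have hint : ∀ r, Integrable (g r) := fun r =>
    (show Continuous (g r) by fun_prop).integrable_of_hasCompactSupport
      (HasCompactSupport.intro hk fun t ht => hgk r t ht)
  have hval : ∀ r z, convolution H (g r) (ContinuousLinearMap.mul ℝ ℝ) volume z
      = ∫ t in Iic z, ψ (t, r) := by
    intro r z
    rw [convolution_eq_swap, ← integral_indicator measurableSet_Iic]
    refine integral_congr_ae (ae_of_all _ fun t => ?_)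
    by_cases h : t ≤ z
    · simp [H, g, indicator, h]
    · simp [H, g, indicator, h]
  have hφ : ∀ x : ℝ × ℝ, (∫ t in (0 : ℝ)..x.1, ψ (t, x.2)) =
      convolution H (g x.2) (ContinuousLinearMap.mul ℝ ℝ) volume x.1 -
      convolution H (g x.2) (ContinuousLinearMap.mul ℝ ℝ) volume 0 := by
    intro x
    rw [hval, hval, intervalIntegral.integral_Iic_sub_Iic]
    · exact (hint x.2).integrableOn
    · exact (hint x.2).integrableOn
  have hsmooth : ContDiff ℝ ∞ fun x : ℝ × ℝ => ∫ t in (0 : ℝ)..x.1, ψ (t, x.2) := by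
    simp_rw [hφ]
    exact (hsm.comp (contDiff_snd.prodMk contDiff_fst)).sub
      (hsm.comp (contDiff_snd.prodMk (contDiff_const (c := (0 : ℝ)))))
  refine ⟨_, hsmooth, fun x => ?_, fun r => by simp⟩
  have h1 := hasDerivAt_fst hsmooth x.1 x.2
  have h2 : HasDerivAt (fun s => ∫ t in (0 : ℝ)..s, ψ (t, x.2)) (ψ (x.1, x.2)) x.1 :=
    (show Continuous fun t => ψ (t, x.2) by fun_prop).integral_hasStrictDerivAt 0 x.1 |>.hasDerivAt
  exact h1.unique h2

/-- Poincaré inequality for smooth functions vanishing on `z = 0`, by integrating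
`∂_z ((z - L) φ²)`. -/
theorem norm_ofCont_le_of_vanish_inlet {L R : ℝ} (hL : 0 < L) {φ : ℝ × ℝ → ℝ}
    (hφ : ContDiff ℝ ∞ φ) (h0 : ∀ r, φ (0, r) = 0) :
    ‖L2Rect.ofCont L R φ hφ.continuous‖ ≤
      2 * L * ‖L2Rect.ofCont L R _ (continuous_fderiv_apply hφ (1, 0))‖ := by
  have hc := hφ.continuous
  have hd := continuous_fderiv_apply hφ (1, 0)
  have hw : ContDiff ℝ ∞ fun x : ℝ × ℝ => x.1 - L := contDiff_fst.sub contDiff_const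
  -- the weight `z - L` vanishes on the outlet and `φ` on the inlet, so no boundary term is left
  have hF : ContDiff ℝ ∞ fun x : ℝ × ℝ => (x.1 - L) * (φ x * φ x) := hw.mul (hφ.mul hφ)
  have hder : ∀ x : ℝ × ℝ, fderiv ℝ (fun x : ℝ × ℝ => (x.1 - L) * (φ x * φ x)) x (1, 0)
      = φ x ^ 2 + 2 * (x.1 - L) * (φ x * fderiv ℝ φ x (1, 0)) := by
    intro x
    rw [fderiv_mul_apply hw (hφ.mul hφ), fderiv_mul_apply hφ hφ]
    have : fderiv ℝ (fun x : ℝ × ℝ => x.1 - L) x (1, 0) = 1 := by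
      rw [fderiv_sub_const, fderiv_fst]; simp
    rw [this]; ring
  have hI := integral_rect_fderiv_fst (R := R) hL hF
  simp only [hder, sub_self, zero_mul, h0, mul_zero, integral_zero] at hI
  rw [integral_add (integrableOn_rect (by fun_prop)) (integrableOn_rect (by fun_prop))] at hI
  have hle : -∫ x in rect L R, 2 * (x.1 - L) * (φ x * fderiv ℝ φ x (1, 0)) ≤
      ∫ x in rect L R, ((1 / 2) * φ x ^ 2 + 2 * L ^ 2 * (fderiv ℝ φ x (1, 0)) ^ 2) := by
    rw [← integral_neg]
    refine setIntegral_mono_on (integrableOn_rect (by fun_prop)) (integrableOn_rect (by fun_prop))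
      (measurableSet_rect L R) fun x hx => ?_
    have hx1 : 0 < x.1 ∧ x.1 < L := hx.1
    have : (x.1 - L) ^ 2 ≤ L ^ 2 := by nlinarith
    nlinarith [sq_nonneg (φ x + 2 * (x.1 - L) * fderiv ℝ φ x (1, 0)),
      mul_le_mul_of_nonneg_right this (sq_nonneg (fderiv ℝ φ x (1, 0)))]
  rw [integral_add (integrableOn_rect (by fun_prop)) (integrableOn_rect (by fun_prop)),
    integral_const_mul, integral_const_mul] at hle
  rw [← L2Rect.norm_sq_ofCont hc, ← L2Rect.norm_sq_ofCont hd] at hle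
  rw [← L2Rect.norm_sq_ofCont hc] at hI
  refine abs_le_of_sq_le_sq' ?_ (by positivity) |>.2
  nlinarith

/-! ### The space `H¹` of the rectangle -/

namespace H1Rect
variable {L R : ℝ}

theorem green_z_inner (q : H1Rect L R) {φ : ℝ × ℝ → ℝ} (hφ : ContDiff ℝ ∞ φ) :
    inner ℝ q.val (L2Rect.ofCont L R _ (continuous_fderiv_apply hφ (1, 0))) =
      -inner ℝ q.dz (L2Rect.ofCont L R φ hφ.continuous)
      + (inner ℝ q.trOut
          (L2Interval.ofCont R (fun r => φ (L, r)) (hφ.continuous.comp (by fun_prop)))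
        - inner ℝ q.trIn
          (L2Interval.ofCont R (fun r => φ (0, r)) (hφ.continuous.comp (by fun_prop)))) := by
  simp only [L2Rect.inner_ofCont, L2Interval.inner_ofCont]
  exact q.green_z φ hφ

theorem green_r_inner (q : H1Rect L R) {φ : ℝ × ℝ → ℝ} (hφ : ContDiff ℝ ∞ φ) :
    inner ℝ q.val (L2Rect.ofCont L R _ (continuous_fderiv_apply hφ (0, 1))) =
      -inner ℝ q.dr (L2Rect.ofCont L R φ hφ.continuous)
      + (inner ℝ q.trTop
          (L2Interval.ofCont L (fun z => φ (z, R)) (hφ.continuous.comp (by fun_prop)))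
        - inner ℝ q.trBot
          (L2Interval.ofCont L (fun z => φ (z, 0)) (hφ.continuous.comp (by fun_prop)))) := by
  simp only [L2Rect.inner_ofCont, L2Interval.inner_ofCont]
  exact q.green_r φ hφ

/-- An element of `H¹` from Green's formulas written with the inner products of `L²`. -/
def ofInner (val dz dr : L2Rect L R) (trIn trOut : L2Interval R) (trBot trTop : L2Interval L)
    (hz : ∀ (φ : ℝ × ℝ → ℝ) (hφ : ContDiff ℝ ∞ φ),
      inner ℝ val (L2Rect.ofCont L R _ (continuous_fderiv_apply hφ (1, 0))) =
        -inner ℝ dz (L2Rect.ofCont L R φ hφ.continuous)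
        + (inner ℝ trOut
            (L2Interval.ofCont R (fun r => φ (L, r)) (hφ.continuous.comp (by fun_prop)))
          - inner ℝ trIn
            (L2Interval.ofCont R (fun r => φ (0, r)) (hφ.continuous.comp (by fun_prop)))))
    (hr : ∀ (φ : ℝ × ℝ → ℝ) (hφ : ContDiff ℝ ∞ φ),
      inner ℝ val (L2Rect.ofCont L R _ (continuous_fderiv_apply hφ (0, 1))) =
        -inner ℝ dr (L2Rect.ofCont L R φ hφ.continuous)
        + (inner ℝ trTop
            (L2Interval.ofCont L (fun z => φ (z, R)) (hφ.continuous.comp (by fun_prop)))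
          - inner ℝ trBot
            (L2Interval.ofCont L (fun z => φ (z, 0)) (hφ.continuous.comp (by fun_prop))))) :
    H1Rect L R where
  val := val
  dz := dz
  dr := dr
  trIn := trIn
  trOut := trOut
  trBot := trBot
  trTop := trTop
  green_z φ hφ := by
    simpa only [L2Rect.inner_ofCont, L2Interval.inner_ofCont] using hz φ hφ
  green_r φ hφ := by
    simpa only [L2Rect.inner_ofCont, L2Interval.inner_ofCont] using hr φ hφ

/-- The linear combination `a u + b v`. -/
def lin (a b : ℝ) (u v : H1Rect L R) : H1Rect L R :=
  ofInner (a • u.val + b • v.val) (a • u.dz + b • v.dz) (a • u.dr + b • v.dr)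
    (a • u.trIn + b • v.trIn) (a • u.trOut + b • v.trOut) (a • u.trBot + b • v.trBot)
    (a • u.trTop + b • v.trTop)
    (fun φ hφ => by
      simp only [inner_add_left, real_inner_smul_left, u.green_z_inner hφ, v.green_z_inner hφ]
      ring)
    (fun φ hφ => by
      simp only [inner_add_left, real_inner_smul_left, u.green_r_inner hφ, v.green_r_inner hφ]
      ring)

section lin
variable (a b : ℝ) (u v : H1Rect L R)
@[simp] theorem lin_val : (lin a b u v).val = a • u.val + b • v.val := rfl
@[simp] theorem lin_dz : (lin a b u v).dz = a • u.dz + b • v.dz := rfl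
@[simp] theorem lin_dr : (lin a b u v).dr = a • u.dr + b • v.dr := rfl
@[simp] theorem lin_trIn : (lin a b u v).trIn = a • u.trIn + b • v.trIn := rfl
@[simp] theorem lin_trOut : (lin a b u v).trOut = a • u.trOut + b • v.trOut := rfl
@[simp] theorem lin_trBot : (lin a b u v).trBot = a • u.trBot + b • v.trBot := rfl
@[simp] theorem lin_trTop : (lin a b u v).trTop = a • u.trTop + b • v.trTop := rfl
end lin

/-- A smooth function on the plane as an element of `H¹`. -/
def ofSmooth (hL : 0 < L) (hR : 0 < R) (u : ℝ × ℝ → ℝ) (hu : ContDiff ℝ ∞ u) : H1Rect L R :=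
  ofInner (L2Rect.ofCont L R u hu.continuous)
    (L2Rect.ofCont L R _ (continuous_fderiv_apply hu (1, 0)))
    (L2Rect.ofCont L R _ (continuous_fderiv_apply hu (0, 1)))
    (L2Interval.ofCont R (fun r => u (0, r)) (hu.continuous.comp (by fun_prop)))
    (L2Interval.ofCont R (fun r => u (L, r)) (hu.continuous.comp (by fun_prop)))
    (L2Interval.ofCont L (fun z => u (z, 0)) (hu.continuous.comp (by fun_prop)))
    (L2Interval.ofCont L (fun z => u (z, R)) (hu.continuous.comp (by fun_prop)))
    (fun φ hφ => by
      have hI := integral_rect_fderiv_fst (R := R) hL (hu.mul hφ)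
      have h1 := continuous_fderiv_apply hu (1, 0)
      have h2 := continuous_fderiv_apply hφ (1, 0)
      have h3 := hu.continuous
      have h4 := hφ.continuous
      simp only [fderiv_mul_apply hu hφ] at hI
      rw [integral_add (integrableOn_rect (by fun_prop)) (integrableOn_rect (by fun_prop))] at hI
      simp only [L2Rect.inner_ofCont_ofCont, L2Interval.inner_ofCont_ofCont]
      linarith)
    (fun φ hφ => by
      have hI := integral_rect_fderiv_snd (L := L) hR (hu.mul hφ)
      have h1 := continuous_fderiv_apply hu (0, 1)
      have h2 := continuous_fderiv_apply hφ (0, 1)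
      have h3 := hu.continuous
      have h4 := hφ.continuous
      simp only [fderiv_mul_apply hu hφ] at hI
      rw [integral_add (integrableOn_rect (by fun_prop)) (integrableOn_rect (by fun_prop))] at hI
      simp only [L2Rect.inner_ofCont_ofCont, L2Interval.inner_ofCont_ofCont]
      linarith)

/-- Poincaré inequality on `Q`, by duality: every smooth compactly supported function is
the `z`-derivative of a test function of Green's formula. -/
theorem norm_val_le (hL : 0 < L) (q : H1Rect L R) (h0 : q.trIn = 0) (h1 : q.trOut = 0) :
    ‖q.val‖ ≤ 2 * L * ‖q.dz‖ := by
  refine L2Rect.norm_le_of_inner_le _ (by positivity) fun ψ hψ hs => ?_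
  obtain ⟨φ, hφ, hd, hφ0⟩ := exists_primitive_fst hψ hs
  have hg := q.green_z_inner hφ
  have hn := norm_ofCont_le_of_vanish_inlet (R := R) hL hφ hφ0
  simp only [hd] at hg hn
  rw [hg, h0, h1, inner_zero_left, inner_zero_left, sub_zero, add_zero]
  have := neg_le_of_abs_le (abs_real_inner_le_norm q.dz (L2Rect.ofCont L R φ hφ.continuous))
  nlinarith [norm_nonneg q.dz]

/-- Trace estimates on the two horizontal sides, tested with a product `g(r) ψ(z)` where `g` is
affine and equal to `1` on one side and to `0` on the other. -/
theorem inner_trace_le (hR : 0 < R) (q : H1Rect L R) {ψ : ℝ → ℝ} (hψ : ContDiff ℝ ∞ ψ)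
    {α β : ℝ} (hα : |α| ≤ 1 / R) (hb : ∀ r ∈ Ioo 0 R, |α * r + β| ≤ 1) :
    (α * R + β) * inner ℝ q.trTop (L2Interval.ofCont L ψ hψ.continuous)
      - β * inner ℝ q.trBot (L2Interval.ofCont L ψ hψ.continuous) ≤
    (1 / R + 1) * √R * (‖q.val‖ + ‖q.dr‖) * ‖L2Interval.ofCont L ψ hψ.continuous‖ := by
  have hψc := hψ.continuous
  have hψ' : ContDiff ℝ ∞ fun x : ℝ × ℝ => ψ x.1 := hψ.comp contDiff_fst
  have hl : ContDiff ℝ ∞ fun x : ℝ × ℝ => α * x.2 + β :=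
    (contDiff_const.mul contDiff_snd).add contDiff_const
  have hφ : ContDiff ℝ ∞ fun x : ℝ × ℝ => (α * x.2 + β) * ψ x.1 := hl.mul hψ'
  have hd : ∀ x : ℝ × ℝ, fderiv ℝ (fun x : ℝ × ℝ => (α * x.2 + β) * ψ x.1) x (0, 1) =
      α * ψ x.1 := by
    intro x
    have h1 : HasDerivAt (fun s => (α * s + β) * ψ x.1) (α * ψ x.1) x.2 := by
      simpa using (((hasDerivAt_id x.2).const_mul α).add_const β).mul_const (ψ x.1)
    exact (hasDerivAt_snd hφ x.1 x.2).unique h1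
  -- a function of the rectangle dominated by `c |ψ(z)|` has norm at most `c √R ‖ψ‖`
  have hbound : ∀ (f : ℝ × ℝ → ℝ) (hf : Continuous f) (c : ℝ), 0 ≤ c →
      (∀ x ∈ rect L R, |f x| ≤ c * |ψ x.1|) →
      ‖L2Rect.ofCont L R f hf‖ ≤ c * √R * ‖L2Interval.ofCont L ψ hψc‖ := by
    intro f hf c hc hfb
    refine abs_le_of_sq_le_sq' ?_ (by positivity) |>.2
    rw [mul_pow, mul_pow, Real.sq_sqrt hR.le, L2Rect.norm_sq_ofCont, L2Interval.norm_sq_ofCont]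
    have h1 : ∫ x in rect L R, f x ^ 2 ≤ ∫ x in rect L R, c ^ 2 * (ψ x.1 ^ 2 * 1) := by
      refine setIntegral_mono_on (integrableOn_rect (by fun_prop))
        (integrableOn_rect (by fun_prop)) (measurableSet_rect L R) fun x hx => ?_
      have := pow_le_pow_left₀ (abs_nonneg _) (hfb x hx) 2
      rwa [mul_pow, sq_abs, sq_abs, ← mul_one (ψ x.1 ^ 2)] at this
    refine h1.trans_eq ?_
    rw [integral_const_mul, rect, Measure.volume_eq_prod,
      setIntegral_prod_mul (fun z => ψ z ^ 2) (fun _ => (1 : ℝ))]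
    simp [hR.le]
    ring
  have hg := q.green_r_inner hφ
  simp only [hd] at hg
  have e1 : L2Interval.ofCont L (fun z => (α * R + β) * ψ z) (by fun_prop)
      = (α * R + β) • L2Interval.ofCont L ψ hψc := rfl
  have e2 : L2Interval.ofCont L (fun z => (α * 0 + β) * ψ z) (by fun_prop)
      = β • L2Interval.ofCont L ψ hψc := by
    simp only [mul_zero, zero_add]
    rfl
  rw [e1, e2, real_inner_smul_right, real_inner_smul_right] at hg
  have b1 := hbound (fun x => α * ψ x.1) (by fun_prop) (1 / R) (by positivity) fun x _ => by
    rw [abs_mul]; gcongr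
  have b2 := hbound (fun x => (α * x.2 + β) * ψ x.1) (by fun_prop) 1 (by positivity) fun x hx => by
    rw [abs_mul]; gcongr; exact hb _ hx.2
  have c1 := real_inner_le_norm q.val (L2Rect.ofCont L R (fun x => α * ψ x.1) (by fun_prop))
  have c2 := real_inner_le_norm q.dr
    (L2Rect.ofCont L R (fun x => (α * x.2 + β) * ψ x.1) (by fun_prop))
  have d1 := mul_le_mul_of_nonneg_left b1 (norm_nonneg q.val)
  have d2 := mul_le_mul_of_nonneg_left b2 (norm_nonneg q.dr)
  have : 0 ≤ √R * ‖L2Interval.ofCont L ψ hψc‖ := by positivity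
  have f1 : 0 ≤ ‖q.val‖ * (√R * ‖L2Interval.ofCont L ψ hψc‖) := by positivity
  have f2 : 0 ≤ 1 / R * (‖q.dr‖ * (√R * ‖L2Interval.ofCont L ψ hψc‖)) := by positivity
  linarith

theorem norm_trTop_le (hR : 0 < R) (q : H1Rect L R) :
    ‖q.trTop‖ ≤ (1 / R + 1) * √R * (‖q.val‖ + ‖q.dr‖) := by
  refine L2Interval.norm_le_of_inner_le _ (by positivity) fun ψ hψ => ?_
  have := q.inner_trace_le hR hψ (α := 1 / R) (β := 0) (by rw [abs_of_nonneg (by positivity)])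
    fun r hr => by
      have h1 := hr.1
      rw [add_zero, abs_of_nonneg (by positivity), one_div_mul_eq_div, div_le_one hR]
      exact hr.2.le
  rwa [add_zero, one_div_mul_cancel hR.ne', one_mul, zero_mul, sub_zero] at this

theorem norm_trBot_le (hR : 0 < R) (q : H1Rect L R) :
    ‖q.trBot‖ ≤ (1 / R + 1) * √R * (‖q.val‖ + ‖q.dr‖) := by
  refine L2Interval.norm_le_of_inner_le _ (by positivity) fun ψ hψ => ?_
  have := q.inner_trace_le hR hψ (α := 1 / R) (β := -1) (by rw [abs_of_nonneg (by positivity)])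
    fun r hr => by
      have h1 := hr.1
      have h2 : 1 / R * r ≤ 1 := by rw [one_div_mul_eq_div, div_le_one hR]; exact hr.2.le
      have h3 : 0 ≤ 1 / R * r := by positivity
      rw [abs_le]; constructor <;> linarith
  rwa [one_div_mul_cancel hR.ne', add_neg_cancel, zero_mul, zero_sub, neg_one_mul, neg_neg] at this

end H1Rect

/-! ### Coercive problems -/

/-- Lax–Milgram for a bounded coercive operator. -/
theorem exists_rightInverse_of_coercive {V : Type*} [NormedAddCommGroup V] [InnerProductSpace ℝ V]
    [CompleteSpace V] (A : V →L[ℝ] V) {c : ℝ} (hc : 0 < c)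
    (h : ∀ v, c * ‖v‖ ^ 2 ≤ inner ℝ (A v) v) : ∃ G : V →L[ℝ] V, ∀ f, A (G f) = f := by
  have hB : IsCoercive ((innerSL ℝ) ∘L A) :=
    ⟨c, hc, fun u => by
    have := h u
    rw [sq, ← mul_assoc] at this
    exact this⟩
  have hA : ∀ v, hB.continuousLinearEquivOfBilin v = A v := fun v => by
    refine ext_inner_right ℝ fun w => ?_
    rw [hB.continuousLinearEquivOfBilin_apply]
    rfl
  refine ⟨hB.continuousLinearEquivOfBilin.symm, fun f => ?_⟩
  rw [← hA]
  exact hB.continuousLinearEquivOfBilin.apply_symm_apply f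

/-- If `D₁` and `D₂` control the norm of `V`, the form `⟨D₁u, D₁v⟩ + ⟨D₂u, D₂v⟩ + c⟨Tu, Tv⟩`
represents every functional built from `D₁`, `D₂` and `T`. For functionals of `T` alone the
solution is given by a bounded operator. -/
theorem exists_represent_of_coercive {V X Y : Type*} [NormedAddCommGroup V]
    [InnerProductSpace ℝ V] [CompleteSpace V] [NormedAddCommGroup X] [InnerProductSpace ℝ X]
    [CompleteSpace X] [NormedAddCommGroup Y] [InnerProductSpace ℝ Y] [CompleteSpace Y]
    (D₁ D₂ : V →L[ℝ] X) (T : V →L[ℝ] Y) {c k : ℝ} (hc : 0 ≤ c) (hk : 0 < k)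
    (h : ∀ v, k * ‖v‖ ^ 2 ≤ ‖D₁ v‖ ^ 2 + ‖D₂ v‖ ^ 2) :
    (∀ (f g : X) (w : Y), ∃ u, ∀ v, inner ℝ (D₁ u) (D₁ v) + inner ℝ (D₂ u) (D₂ v)
      + c * inner ℝ (T u) (T v) = inner ℝ f (D₁ v) + inner ℝ g (D₂ v) + inner ℝ w (T v)) ∧
    ∃ G : Y →L[ℝ] V, ∀ w v, inner ℝ (D₁ (G w)) (D₁ v) + inner ℝ (D₂ (G w)) (D₂ v)
      + c * inner ℝ (T (G w)) (T v) = inner ℝ w (T v) := by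
  let A : V →L[ℝ] V := (ContinuousLinearMap.adjoint D₁) ∘L D₁
    + (ContinuousLinearMap.adjoint D₂) ∘L D₂ + c • ((ContinuousLinearMap.adjoint T) ∘L T)
  have hA : ∀ u v : V, inner ℝ (A u) v =
      inner ℝ (D₁ u) (D₁ v) + inner ℝ (D₂ u) (D₂ v) + c * inner ℝ (T u) (T v) := by
    intro u v
    simp only [A, add_apply, smul_apply, ContinuousLinearMap.comp_apply, inner_add_left,
      real_inner_smul_left, ContinuousLinearMap.adjoint_inner_left]
  obtain ⟨G, hG⟩ := exists_rightInverse_of_coercive A hk (by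
    intro v
    rw [hA, real_inner_self_eq_norm_sq, real_inner_self_eq_norm_sq, real_inner_self_eq_norm_sq]
    have := mul_nonneg hc (sq_nonneg ‖T v‖)
    linarith [h v])
  refine ⟨fun f g w => ⟨G (ContinuousLinearMap.adjoint D₁ f + ContinuousLinearMap.adjoint D₂ g
    + ContinuousLinearMap.adjoint T w), fun v => ?_⟩,
    G ∘L ContinuousLinearMap.adjoint T, fun w v => ?_⟩
  · rw [← hA, hG]
    simp only [inner_add_left, ContinuousLinearMap.adjoint_inner_left]
  · rw [← hA, ContinuousLinearMap.comp_apply, hG, ContinuousLinearMap.adjoint_inner_left]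

/-! ### The test space `Q` as a Hilbert space -/

/-- The ambient space of the tuples `(val, dz, dr, trBot, trTop)`. -/
abbrev QAmbient (L R : ℝ) : Type :=
  WithLp 2 (L2Rect L R × WithLp 2 (L2Rect L R × WithLp 2 (L2Rect L R ×
    WithLp 2 (L2Interval L × L2Interval L))))

/-- The space `Q` of the functions of `H¹` vanishing on inlet and outlet, as a closed subspace
of a product of `L²` spaces cut out by Green's formulas. -/
def QSpace (L R : ℝ) : Submodule ℝ (QAmbient L R) where
  carrier := {x | (∀ (φ : ℝ × ℝ → ℝ) (hφ : ContDiff ℝ ∞ φ),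
      inner ℝ x.fst (L2Rect.ofCont L R _ (continuous_fderiv_apply hφ (1, 0))) =
        -inner ℝ x.snd.fst (L2Rect.ofCont L R φ hφ.continuous)) ∧
    ∀ (φ : ℝ × ℝ → ℝ) (hφ : ContDiff ℝ ∞ φ),
      inner ℝ x.fst (L2Rect.ofCont L R _ (continuous_fderiv_apply hφ (0, 1))) =
        -inner ℝ x.snd.snd.fst (L2Rect.ofCont L R φ hφ.continuous)
        + (inner ℝ x.snd.snd.snd.snd
            (L2Interval.ofCont L (fun z => φ (z, R)) (hφ.continuous.comp (by fun_prop)))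
          - inner ℝ x.snd.snd.snd.fst
            (L2Interval.ofCont L (fun z => φ (z, 0)) (hφ.continuous.comp (by fun_prop))))}
  add_mem' := by
    rintro x y ⟨hx1, hx2⟩ ⟨hy1, hy2⟩
    refine ⟨fun φ hφ => ?_, fun φ hφ => ?_⟩
    · simp only [WithLp.add_fst, WithLp.add_snd, inner_add_left, hx1 φ hφ, hy1 φ hφ]; ring
    · simp only [WithLp.add_fst, WithLp.add_snd, inner_add_left, hx2 φ hφ, hy2 φ hφ]; ring
  zero_mem' := by simp
  smul_mem' := by
    rintro c x ⟨hx1, hx2⟩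
    refine ⟨fun φ hφ => ?_, fun φ hφ => ?_⟩
    · simp only [WithLp.smul_fst, WithLp.smul_snd, real_inner_smul_left, hx1 φ hφ]; ring
    · simp only [WithLp.smul_fst, WithLp.smul_snd, real_inner_smul_left, hx2 φ hφ]; ring

theorem isClosed_QSpace (L R : ℝ) : IsClosed (QSpace L R : Set (QAmbient L R)) := by
  have c1 : Continuous fun x : QAmbient L R => x.fst := WithLp.continuous_fst ..
  have c2 : Continuous fun x : QAmbient L R => x.snd := WithLp.continuous_snd ..
  have c3 : Continuous fun x : QAmbient L R => x.snd.fst := (WithLp.continuous_fst ..).comp c2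
  have c4 : Continuous fun x : QAmbient L R => x.snd.snd := (WithLp.continuous_snd ..).comp c2
  have c5 : Continuous fun x : QAmbient L R => x.snd.snd.fst := (WithLp.continuous_fst ..).comp c4
  have c6 : Continuous fun x : QAmbient L R => x.snd.snd.snd := (WithLp.continuous_snd ..).comp c4
  have c7 : Continuous fun x : QAmbient L R => x.snd.snd.snd.fst :=
    (WithLp.continuous_fst ..).comp c6
  have c8 : Continuous fun x : QAmbient L R => x.snd.snd.snd.snd :=
    (WithLp.continuous_snd ..).comp c6
  have : (QSpace L R : Set (QAmbient L R)) = {x | x ∈ QSpace L R} := rfl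
  rw [this]
  change IsClosed {x : QAmbient L R | _ ∧ _}
  simp only [ofPred_and, ofPred_forall]
  refine IsClosed.inter ?_ ?_
  · refine isClosed_iInter fun φ => isClosed_iInter fun hφ => isClosed_eq ?_ ?_ <;> fun_prop
  · refine isClosed_iInter fun φ => isClosed_iInter fun hφ => isClosed_eq ?_ ?_ <;> fun_prop

instance (L R : ℝ) : CompleteSpace (QSpace L R) :=
  (isClosed_QSpace L R).completeSpace_coe

namespace QSpace
variable {L R : ℝ}

/-- The `z`-derivative on `Q`. -/
def dzL (L R : ℝ) : QSpace L R →L[ℝ] L2Rect L R :=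
  (WithLp.fstL 2 ℝ _ _) ∘L (WithLp.sndL 2 ℝ _ _) ∘L (QSpace L R).subtypeL

/-- The `r`-derivative on `Q`. -/
def drL (L R : ℝ) : QSpace L R →L[ℝ] L2Rect L R :=
  (WithLp.fstL 2 ℝ _ _) ∘L (WithLp.sndL 2 ℝ _ _) ∘L (WithLp.sndL 2 ℝ _ _) ∘L
    (QSpace L R).subtypeL

/-- The trace on `Γ` on `Q`. -/
def topL (L R : ℝ) : QSpace L R →L[ℝ] L2Interval L :=
  (WithLp.sndL 2 ℝ _ _) ∘L (WithLp.sndL 2 ℝ _ _) ∘L (WithLp.sndL 2 ℝ _ _) ∘L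
    (WithLp.sndL 2 ℝ _ _) ∘L (QSpace L R).subtypeL

/-- The element of `H¹` given by an element of `Q`. -/
def toH1 (x : QSpace L R) : H1Rect L R :=
  H1Rect.ofInner x.1.fst x.1.snd.fst x.1.snd.snd.fst 0 0 x.1.snd.snd.snd.fst x.1.snd.snd.snd.snd
    (fun φ hφ => by
      rw [inner_zero_left, inner_zero_left, sub_zero, add_zero]; exact x.2.1 φ hφ)
    (fun φ hφ => x.2.2 φ hφ)

/-- The element of `Q` given by an element of `H¹` that vanishes on inlet and outlet. -/
def ofH1 (q : H1Rect L R) (h0 : q.trIn = 0) (h1 : q.trOut = 0) : QSpace L R :=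
  ⟨WithLp.toLp 2 (q.val, WithLp.toLp 2 (q.dz, WithLp.toLp 2 (q.dr, WithLp.toLp 2
      (q.trBot, q.trTop)))),
    ⟨fun φ hφ => by
      have := q.green_z_inner hφ
      rwa [h0, h1, inner_zero_left, inner_zero_left, sub_zero, add_zero] at this,
    fun φ hφ => q.green_r_inner hφ⟩⟩

theorem norm_sq (x : QSpace L R) : ‖x‖ ^ 2 = ‖(QSpace.toH1 x).val‖ ^ 2 + (‖(QSpace.toH1 x).dz‖ ^ 2 +
    (‖(QSpace.toH1 x).dr‖ ^ 2 + (‖(QSpace.toH1 x).trBot‖ ^ 2 + ‖(QSpace.toH1 x).trTop‖ ^ 2))) := by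
  rw [Submodule.coe_norm, WithLp.prod_norm_sq_eq_of_L2, WithLp.prod_norm_sq_eq_of_L2,
    WithLp.prod_norm_sq_eq_of_L2, WithLp.prod_norm_sq_eq_of_L2]
  rfl

end QSpace

/-- On `Q` the gradient controls the function and its traces. -/
theorem H1Rect.exists_gradient_bound {L R : ℝ} (hL : 0 < L) (hR : 0 < R) :
    ∃ K : ℝ, 0 < K ∧ ∀ q : H1Rect L R, q.trIn = 0 → q.trOut = 0 →
      ‖q.val‖ ^ 2 ≤ K * (‖q.dz‖ ^ 2 + ‖q.dr‖ ^ 2) ∧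
      ‖q.trTop‖ ^ 2 ≤ K * (‖q.dz‖ ^ 2 + ‖q.dr‖ ^ 2) ∧
      ‖q.trBot‖ ^ 2 ≤ K * (‖q.dz‖ ^ 2 + ‖q.dr‖ ^ 2) := by
  set b := (1 / R + 1) * √R with hb
  have hbpos : 0 < b := by positivity
  refine ⟨(2 * L) ^ 2 + b ^ 2 * ((2 * L) ^ 2 + 1), by positivity, fun q h0 h1 => ?_⟩
  have hv := q.norm_val_le hL h0 h1
  have hv2 : ‖q.val‖ ^ 2 ≤ (2 * L) ^ 2 * ‖q.dz‖ ^ 2 := by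
    rw [← mul_pow]; exact pow_le_pow_left₀ (norm_nonneg _) hv 2
  have key : ∀ t : ℝ, 0 ≤ t → t ≤ b * (‖q.val‖ + ‖q.dr‖) →
      t ^ 2 ≤ b ^ 2 * (((2 * L) ^ 2 + 1) * (‖q.dz‖ ^ 2 + ‖q.dr‖ ^ 2)) := by
    intro t ht htb
    have h2 : t ≤ b * (2 * L * ‖q.dz‖ + ‖q.dr‖) := htb.trans (by gcongr)
    calc t ^ 2 ≤ (b * (2 * L * ‖q.dz‖ + ‖q.dr‖)) ^ 2 := pow_le_pow_left₀ ht h2 2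
      _ = b ^ 2 * (2 * L * ‖q.dz‖ + ‖q.dr‖) ^ 2 := by ring
      _ ≤ _ := by
        gcongr
        nlinarith [sq_nonneg (2 * L * ‖q.dr‖ - ‖q.dz‖)]
  have ht := key _ (norm_nonneg _) (q.norm_trTop_le hR)
  have hbt := key _ (norm_nonneg _) (q.norm_trBot_le hR)
  have p1 : 0 ≤ (2 * L) ^ 2 * ‖q.dr‖ ^ 2 := by positivity
  have p2 : 0 ≤ (2 * L) ^ 2 * ‖q.dz‖ ^ 2 := by positivity
  have p3 : 0 ≤ b ^ 2 * (((2 * L) ^ 2 + 1) * (‖q.dz‖ ^ 2 + ‖q.dr‖ ^ 2)) := by positivity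
  refine ⟨?_, ?_, ?_⟩ <;> nlinarith

/-- An element of `Q` with zero gradient is zero; this includes its traces. -/
theorem H1Rect.eq_of_gradient_eq {L R : ℝ} (hL : 0 < L) (hR : 0 < R) {u v : H1Rect L R}
    (hin : u.trIn = v.trIn) (hout : u.trOut = v.trOut) (hz : u.dz = v.dz) (hr : u.dr = v.dr) :
    u = v := by
  obtain ⟨K, -, hK⟩ := H1Rect.exists_gradient_bound hL hR
  obtain ⟨h1, h2, h3⟩ := hK (H1Rect.lin 1 (-1) u v) (by simp [hin]) (by simp [hout])
  have h0 : ‖(H1Rect.lin 1 (-1) u v).dz‖ ^ 2 + ‖(H1Rect.lin 1 (-1) u v).dr‖ ^ 2 = 0 := by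
    simp [hz, hr]
  rw [h0, mul_zero] at h1 h2 h3
  have fin : ∀ {X : Type} [NormedAddCommGroup X] [NormedSpace ℝ X] {a b : X},
      ‖(1 : ℝ) • a + (-1 : ℝ) • b‖ ^ 2 ≤ 0 → a = b := by
    intro X _ _ a b h
    have := pow_eq_zero_iff two_ne_zero |>.1 (le_antisymm h (sq_nonneg _))
    rwa [one_smul, neg_one_smul, ← sub_eq_add_neg, norm_eq_zero, sub_eq_zero] at this
  exact H1Rect.ext (fin h1) hz hr hin hout (fin h3) (fin h2)

/-! ### The weak problems -/

/-- The bilinear form `∫ ∇u·∇φ + c ∫_Γ u φ`; `c = κ⁻¹` belongs to the Robin problem and `c = 0` to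
the Neumann problem. -/
def H1Rect.form {L R : ℝ} (c : ℝ) (u φ : H1Rect L R) : ℝ :=
  inner ℝ u.dz φ.dz + inner ℝ u.dr φ.dr + c * inner ℝ u.trTop φ.trTop

theorem H1Rect.form_self {L R : ℝ} (c : ℝ) (u : H1Rect L R) :
    u.form c u = ‖u.dz‖ ^ 2 + ‖u.dr‖ ^ 2 + c * ‖u.trTop‖ ^ 2 := by
  simp only [H1Rect.form, real_inner_self_eq_norm_sq]

theorem H1Rect.form_lin_left {L R : ℝ} (c a b : ℝ) (u v φ : H1Rect L R) :
    (H1Rect.lin a b u v).form c φ = a * u.form c φ + b * v.form c φ := by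
  simp only [H1Rect.form, H1Rect.lin_dz, H1Rect.lin_dr, H1Rect.lin_trTop, inner_add_left,
    real_inner_smul_left]
  ring

/-- Uniqueness for all weak problems with prescribed values on inlet and outlet. -/
theorem H1Rect.eq_of_form_eq {L R : ℝ} (hL : 0 < L) (hR : 0 < R) {c : ℝ} (hc : 0 ≤ c)
    {u v : H1Rect L R} (hin : u.trIn = v.trIn) (hout : u.trOut = v.trOut)
    (h : ∀ φ : H1Rect L R, φ.trIn = 0 → φ.trOut = 0 → u.form c φ = v.form c φ) : u = v := by
  have h0 := h (H1Rect.lin 1 (-1) u v) (by simp [hin]) (by simp [hout])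
  have h1 : (H1Rect.lin 1 (-1) u v).form c (H1Rect.lin 1 (-1) u v) = 0 := by
    rw [H1Rect.form_lin_left, h0]; ring
  rw [H1Rect.form_self] at h1
  have p1 := sq_nonneg ‖(H1Rect.lin 1 (-1) u v).dz‖
  have p2 := sq_nonneg ‖(H1Rect.lin 1 (-1) u v).dr‖
  have p3 := mul_nonneg hc (sq_nonneg ‖(H1Rect.lin 1 (-1) u v).trTop‖)
  have hz : ‖(H1Rect.lin 1 (-1) u v).dz‖ ^ 2 = 0 := by linarith
  have hr : ‖(H1Rect.lin 1 (-1) u v).dr‖ ^ 2 = 0 := by linarith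
  rw [pow_eq_zero_iff two_ne_zero, norm_eq_zero, H1Rect.lin_dz, one_smul, neg_one_smul,
    ← sub_eq_add_neg, sub_eq_zero] at hz
  rw [pow_eq_zero_iff two_ne_zero, norm_eq_zero, H1Rect.lin_dr, one_smul, neg_one_smul,
    ← sub_eq_add_neg, sub_eq_zero] at hr
  exact H1Rect.eq_of_gradient_eq hL hR hin hout hz hr

/-- Solvability on `Q`: the gradient controls the norm by the Poincaré and trace inequalities. -/
theorem H1Rect.exists_represent {L R : ℝ} (hL : 0 < L) (hR : 0 < R) {c : ℝ} (hc : 0 ≤ c) :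
    (∀ (f g : L2Rect L R) (w : L2Interval L), ∃ u : QSpace L R, ∀ v : QSpace L R,
      (QSpace.toH1 u).form c (QSpace.toH1 v) = inner ℝ f (QSpace.toH1 v).dz
        + inner ℝ g (QSpace.toH1 v).dr + inner ℝ w (QSpace.toH1 v).trTop) ∧
    ∃ G : L2Interval L →L[ℝ] QSpace L R, ∀ (w : L2Interval L) (v : QSpace L R),
      (QSpace.toH1 (G w)).form c (QSpace.toH1 v) = inner ℝ w (QSpace.toH1 v).trTop := by
  obtain ⟨K, hK, hbd⟩ := H1Rect.exists_gradient_bound hL hR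
  refine exists_represent_of_coercive (V := QSpace L R) (QSpace.dzL L R) (QSpace.drL L R)
    (QSpace.topL L R) hc (k := 1 / (3 * K + 1)) (by positivity) fun v => ?_
  obtain ⟨h1, h2, h3⟩ := hbd (QSpace.toH1 v) rfl rfl
  rw [one_div_mul_eq_div, div_le_iff₀ (by positivity), QSpace.norm_sq]
  change _ ≤ (‖(QSpace.toH1 v).dz‖ ^ 2 + ‖(QSpace.toH1 v).dr‖ ^ 2) * _
  linarith

theorem H1Rect.exists_form_eq {L R : ℝ} (hL : 0 < L) (hR : 0 < R) {c : ℝ} (hc : 0 ≤ c)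
    (f g : L2Rect L R) (w : L2Interval L) :
    ∃ v : H1Rect L R, v.trIn = 0 ∧ v.trOut = 0 ∧
      ∀ φ : H1Rect L R, φ.trIn = 0 → φ.trOut = 0 →
        v.form c φ = inner ℝ f φ.dz + inner ℝ g φ.dr + inner ℝ w φ.trTop := by
  obtain ⟨u, hu⟩ := (H1Rect.exists_represent hL hR hc).1 f g w
  exact ⟨QSpace.toH1 u, rfl, rfl, fun φ h0 h1 => hu (QSpace.ofH1 φ h0 h1)⟩

/-- The trace on `Γ` of the solution with data `w` on `Γ`, as a bounded operator. -/
theorem H1Rect.exists_trace_operator {L R : ℝ} (hL : 0 < L) (hR : 0 < R) {c : ℝ} (hc : 0 ≤ c) :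
    ∃ S : L2Interval L →L[ℝ] L2Interval L, ∀ w, ∃ u : H1Rect L R, u.trIn = 0 ∧ u.trOut = 0 ∧
      (∀ φ : H1Rect L R, φ.trIn = 0 → φ.trOut = 0 → u.form c φ = inner ℝ w φ.trTop) ∧
      S w = u.trTop := by
  obtain ⟨G, hG⟩ := (H1Rect.exists_represent hL hR hc).2
  exact ⟨(QSpace.topL L R) ∘L G, fun w => ⟨QSpace.toH1 (G w), rfl, rfl,
    fun φ h0 h1 => hG w (QSpace.ofH1 φ h0 h1), rfl⟩⟩

section
variable (P : TestProblem)

theorem TestProblem.κ_pos : 0 < P.κ :=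
  div_pos (mul_pos P.ρs_pos P.h_pos) P.ρf_pos

theorem isRobinSolution_iff {L R κ : ℝ} {gIn gOut : L2Interval R} {w : L2Interval L}
    {u : H1Rect L R} : IsRobinSolution κ gIn gOut w u ↔ u.trIn = gIn ∧ u.trOut = gOut ∧
      ∀ φ : H1Rect L R, φ.trIn = 0 → φ.trOut = 0 → u.form κ⁻¹ φ = κ⁻¹ * inner ℝ w φ.trTop :=
  Iff.rfl

theorem isNeumannSolution_iff {L R : ℝ} {w : L2Interval L}
    {u : H1Rect L R} : IsNeumannSolution w u ↔ u.trIn = 0 ∧ u.trOut = 0 ∧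
      ∀ φ : H1Rect L R, φ.trIn = 0 → φ.trOut = 0 → u.form 0 φ = inner ℝ w φ.trTop := by
  simp only [IsNeumannSolution, H1Rect.form, zero_mul, add_zero]

theorem IsRobinSolution.unique {gIn gOut : L2Interval P.R} {w : L2Interval P.L}
    {u v : H1Rect P.L P.R} (hu : IsRobinSolution P.κ gIn gOut w u)
    (hv : IsRobinSolution P.κ gIn gOut w v) : u = v :=
  H1Rect.eq_of_form_eq P.L_pos P.R_pos (inv_nonneg.2 P.κ_pos.le) (hu.1.trans hv.1.symm)
    (hu.2.1.trans hv.2.1.symm) fun φ h0 h1 => (hu.2.2 φ h0 h1).trans (hv.2.2 φ h0 h1).symm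

theorem IsNeumannSolution.unique {w : L2Interval P.L}
    {u v : H1Rect P.L P.R} (hu : IsNeumannSolution w u) (hv : IsNeumannSolution w v) : u = v := by
  rw [isNeumannSolution_iff] at hu hv
  exact H1Rect.eq_of_form_eq P.L_pos P.R_pos le_rfl (hu.1.trans hv.1.symm)
    (hu.2.1.trans hv.2.1.symm) fun φ h0 h1 => (hu.2.2 φ h0 h1).trans (hv.2.2 φ h0 h1).symm

/-- Solutions of the Robin problem depend linearly on the data. -/
theorem IsRobinSolution.lin {L R κ : ℝ} {gIn gOut gIn' gOut' : L2Interval R} {w w' : L2Interval L}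
    {u v : H1Rect L R} (hu : IsRobinSolution κ gIn gOut w u)
    (hv : IsRobinSolution κ gIn' gOut' w' v) (a b : ℝ) :
    IsRobinSolution κ (a • gIn + b • gIn') (a • gOut + b • gOut') (a • w + b • w')
      (H1Rect.lin a b u v) := by
  rw [isRobinSolution_iff] at *
  refine ⟨by simp [hu.1, hv.1], by simp [hu.2.1, hv.2.1], fun φ h0 h1 => ?_⟩
  rw [H1Rect.form_lin_left, hu.2.2 φ h0 h1, hv.2.2 φ h0 h1, inner_add_left, real_inner_smul_left,
    real_inner_smul_left]
  ring

/-- The solution is a lift of the inlet and outlet pressures plus a correction in `Q`. -/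
theorem existsUnique_isRobinSolution {gIn gOut : L2Interval P.R} (w : L2Interval P.L)
    (h : ∃ M, InOutNormLE P.L P.R gIn gOut M) :
    ∃! u : H1Rect P.L P.R, IsRobinSolution P.κ gIn gOut w u := by
  obtain ⟨M, q, rfl, rfl, -⟩ := h
  obtain ⟨v, hv0, hv1, hv⟩ := H1Rect.exists_form_eq P.L_pos P.R_pos (inv_nonneg.2 P.κ_pos.le)
    (-q.dz) (-q.dr) (P.κ⁻¹ • (w - q.trTop))
  refine ⟨H1Rect.lin 1 1 v q, ⟨by simp [hv0], by simp [hv1], fun φ h0 h1 => ?_⟩,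
    fun u hu => IsRobinSolution.unique P hu ⟨by simp [hv0], by simp [hv1], fun φ h0 h1 => ?_⟩⟩ <;>
  · change (H1Rect.lin 1 1 v q).form _ φ = _
    rw [H1Rect.form_lin_left, hv φ h0 h1, H1Rect.form]
    simp only [inner_neg_left, real_inner_smul_left, inner_sub_left]
    ring

theorem existsUnique_isNeumannSolution (w : L2Interval P.L) :
    ∃! u : H1Rect P.L P.R, IsNeumannSolution w u := by
  obtain ⟨v, hv0, hv1, hv⟩ := H1Rect.exists_form_eq P.L_pos P.R_pos le_rfl 0 0 w
  have : IsNeumannSolution w v :=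
    isNeumannSolution_iff.2 ⟨hv0, hv1, fun φ h0 h1 => by simp [hv φ h0 h1]⟩
  exact ⟨v, this, fun u hu => IsNeumannSolution.unique P hu this⟩

theorem exists_isRobinTraceOperator :
    ∃ S : L2Interval P.L →L[ℝ] L2Interval P.L, IsRobinTraceOperator P S := by
  obtain ⟨S, hS⟩ := H1Rect.exists_trace_operator P.L_pos P.R_pos (inv_nonneg.2 P.κ_pos.le)
  refine ⟨P.κ⁻¹ • S, fun w => ?_⟩
  obtain ⟨u, h0, h1, hu, h⟩ := hS (P.κ⁻¹ • w)
  refine ⟨u, ⟨h0, h1, fun φ a b => ?_⟩, by rw [← h, map_smul]; rfl⟩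
  exact (hu φ a b).trans (real_inner_smul_left _ _ _)

theorem exists_isAddedMassOperator :
    ∃ M : L2Interval P.L →L[ℝ] L2Interval P.L, IsAddedMassOperator P M := by
  obtain ⟨S, hS⟩ := H1Rect.exists_trace_operator P.L_pos P.R_pos le_rfl
  refine ⟨S, fun w => ?_⟩
  obtain ⟨u, h0, h1, hu, h⟩ := hS w
  exact ⟨u, isNeumannSolution_iff.2 ⟨h0, h1, hu⟩, h⟩

end

/-! ### The sine basis of `L²(0,L)` -/

/-- The frequency `(j+1) π / L` of the `j`-th mode. -/
def freq (L : ℝ) (j : ℕ) : ℝ := ((j : ℝ) + 1) * Real.pi / L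

theorem freq_pos {L : ℝ} (hL : 0 < L) (j : ℕ) : 0 < freq L j := by
  have := Real.pi_pos
  unfold freq; positivity

theorem freq_mul_self {L : ℝ} (hL : 0 < L) (j : ℕ) :
    freq L j * L = ((j + 1 : ℕ) : ℝ) * Real.pi := by
  rw [freq, div_mul_cancel₀ _ hL.ne']; push_cast; ring

/-- The normalized sine `√(2/L) sin((j+1)πx/L)`. -/
def sineMode (L : ℝ) (j : ℕ) (x : ℝ) : ℝ := √(2 / L) * Real.sin (freq L j * x)

theorem contDiff_sineMode (L : ℝ) (j : ℕ) : ContDiff ℝ ∞ (sineMode L j) :=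
  contDiff_const.mul (Real.contDiff_sin.comp (contDiff_const.mul contDiff_id))

theorem continuous_sineMode (L : ℝ) (j : ℕ) : Continuous (sineMode L j) :=
  (contDiff_sineMode L j).continuous

theorem sineMode_zero (L : ℝ) (j : ℕ) : sineMode L j 0 = 0 := by simp [sineMode]

theorem sineMode_end {L : ℝ} (hL : 0 < L) (j : ℕ) : sineMode L j L = 0 := by
  rw [sineMode, freq_mul_self hL, Real.sin_nat_mul_pi, mul_zero]

/-- The derivative of the normalized sine. -/
def cosineMode (L : ℝ) (j : ℕ) (x : ℝ) : ℝ := √(2 / L) * (freq L j * Real.cos (freq L j * x))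

theorem contDiff_cosineMode (L : ℝ) (j : ℕ) : ContDiff ℝ ∞ (cosineMode L j) :=
  contDiff_const.mul (contDiff_const.mul (Real.contDiff_cos.comp (contDiff_const.mul contDiff_id)))

theorem hasDerivAt_sineMode (L : ℝ) (j : ℕ) (x : ℝ) :
    HasDerivAt (sineMode L j) (cosineMode L j x) x := by
  have := (((hasDerivAt_id x).const_mul (freq L j)).sin).const_mul √(2 / L)
  refine this.congr_deriv ?_
  simp only [cosineMode, id, mul_one]; ring

theorem hasDerivAt_cosineMode (L : ℝ) (j : ℕ) (x : ℝ) :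
    HasDerivAt (cosineMode L j) (-(freq L j) ^ 2 * sineMode L j x) x := by
  have := ((((hasDerivAt_id x).const_mul (freq L j)).cos).const_mul (freq L j)).const_mul √(2 / L)
  refine this.congr_deriv ?_
  simp only [sineMode, id, mul_one]; ring

theorem integral_cos_int_mul {L : ℝ} (hL : 0 < L) {n : ℤ} (hn : n ≠ 0) :
    ∫ x in Ioo 0 L, Real.cos (n * Real.pi / L * x) = 0 := by
  have hn' : (n : ℝ) ≠ 0 := by exact_mod_cast hn
  have hc : (n : ℝ) * Real.pi / L ≠ 0 := by
    have := Real.pi_ne_zero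
    have := hL.ne'
    positivity
  rw [integral_Ioo_of_hasDerivAt hL
    (f := fun x => (n * Real.pi / L)⁻¹ * Real.sin (n * Real.pi / L * x)) (fun x => ?_)
    (by fun_prop)]
  · rw [div_mul_cancel₀ _ hL.ne', Real.sin_int_mul_pi]; simp
  · have := (((hasDerivAt_id x).const_mul (n * Real.pi / L)).sin).const_mul (n * Real.pi / L)⁻¹
    refine this.congr_deriv ?_
    simp only [id, mul_one]
    rw [mul_comm (Real.cos _), inv_mul_cancel_left₀ hc]

theorem integral_sineMode_mul {L : ℝ} (hL : 0 < L) (i j : ℕ) :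
    ∫ x in Ioo 0 L, sineMode L i x * sineMode L j x = if i = j then 1 else 0 := by
  have hs : √(2 / L) * √(2 / L) = 2 / L := Real.mul_self_sqrt (by positivity)
  have h1 : ∀ x, sineMode L i x * sineMode L j x = 1 / L *
      (Real.cos (((i - j : ℤ) : ℝ) * Real.pi / L * x)
        - Real.cos (((i + j + 2 : ℤ) : ℝ) * Real.pi / L * x)) := by
    intro x
    have e1 : ((i - j : ℤ) : ℝ) * Real.pi / L * x = freq L i * x - freq L j * x := by
      simp only [freq]; push_cast; ring
    have e2 : ((i + j + 2 : ℤ) : ℝ) * Real.pi / L * x = freq L i * x + freq L j * x := by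
      simp only [freq]; push_cast; ring
    rw [e1, e2, Real.cos_sub, Real.cos_add, sineMode, sineMode]
    linear_combination (Real.sin (freq L i * x) * Real.sin (freq L j * x)) * hs
  simp_rw [h1]
  rw [integral_const_mul, integral_sub (integrableOn_Ioo_of_continuous (by fun_prop))
    (integrableOn_Ioo_of_continuous (by fun_prop)),
    integral_cos_int_mul hL (n := i + j + 2) (by lia),
    sub_zero]
  split_ifs with h
  · subst h
    simp [hL.le, hL.ne']
  · rw [integral_cos_int_mul hL (by lia), mul_zero]

/-- The class of the normalized sine in `L²(0,L)`. -/
def sineLp (L : ℝ) (j : ℕ) : L2Interval L :=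
  L2Interval.ofCont L (sineMode L j) (continuous_sineMode L j)

theorem orthonormal_sineLp {L : ℝ} (hL : 0 < L) : Orthonormal ℝ (sineLp L) := by
  rw [orthonormal_iff_ite]
  intro i j
  rw [sineLp, sineLp, L2Interval.inner_ofCont_ofCont, integral_sineMode_mul hL]

/-- Completeness of the sines. A function orthogonal to all of them is, after multiplication by
`sin (πx/L)`, orthogonal to all polynomials in `cos (πx/L)`, and these approximate every continuous
function uniformly on `[0,L]`. -/
theorem eq_zero_of_inner_sineLp {L : ℝ} (hL : 0 < L) (f : L2Interval L)
    (h : ∀ j, inner ℝ f (sineLp L j) = 0) : f = 0 := by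
  set a := Real.pi / L with ha
  have hapos : 0 < a := by have := Real.pi_pos; positivity
  have : IsFiniteMeasure (volume.restrict (Ioo 0 L)) := ⟨by simp⟩
  have hf : IntegrableOn f (Ioo 0 L) := (Lp.memLp f).integrable (by norm_num)
  have hfc : ∀ {g : ℝ → ℝ}, Continuous g → IntegrableOn (fun x => f x * g x) (Ioo 0 L) := by
    intro g hg
    exact (Lp.memLp f).integrable_mul
      (memLp_restrict_of_continuous (Metric.isBounded_Ioo 0 L) measurableSet_Ioo hg)
  have hs : ∀ j : ℕ, ∫ x in Ioo 0 L, f x * Real.sin (j * (a * x)) = 0 := by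
    rintro (_ | j)
    · simp
    · have h1 := h j
      rw [sineLp, L2Interval.inner_ofCont] at h1
      have h2 : ∀ x, f x * sineMode L j x =
          √(2 / L) * (f x * Real.sin (((j + 1 : ℕ) : ℝ) * (a * x))) := by
        intro x
        have : freq L j * x = ((j + 1 : ℕ) : ℝ) * (a * x) := by
          simp only [freq, ha]; push_cast; ring
        rw [sineMode, this]; ring
      simp_rw [h2] at h1
      rw [integral_const_mul] at h1
      exact (mul_eq_zero.1 h1).resolve_left (by positivity)
  -- `2 cos t sin ((j+1)t) = sin ((j+2)t) + sin (jt)` raises the power of the cosine by one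
  have hpow : ∀ k j : ℕ,
      ∫ x in Ioo 0 L, f x * (Real.cos (a * x) ^ k * Real.sin (j * (a * x))) = 0 := by
    intro k
    induction k with
    | zero => simpa using hs
    | succ k ih =>
      rintro (_ | j)
      · simp
      · have e : ∀ x, f x * (Real.cos (a * x) ^ (k + 1) * Real.sin (((j + 1 : ℕ) : ℝ) * (a * x))) =
            (1 / 2) * (f x * (Real.cos (a * x) ^ k * Real.sin (((j + 2 : ℕ) : ℝ) * (a * x))))
            + (1 / 2) * (f x * (Real.cos (a * x) ^ k * Real.sin ((j : ℝ) * (a * x)))) := by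
          intro x
          have e1 : ((j + 2 : ℕ) : ℝ) * (a * x) = ((j + 1 : ℕ) : ℝ) * (a * x) + a * x := by
            push_cast; ring
          have e2 : (j : ℝ) * (a * x) = ((j + 1 : ℕ) : ℝ) * (a * x) - a * x := by
            push_cast; ring
          rw [e1, e2, Real.sin_add, Real.sin_sub]; ring
        simp_rw [e]
        rw [integral_add ((hfc (by fun_prop)).const_mul _) ((hfc (by fun_prop)).const_mul _),
          integral_const_mul, integral_const_mul, ih, ih]
        simp
  have hpoly : ∀ p : Polynomial ℝ,
      ∫ x in Ioo 0 L, f x * (p.eval (Real.cos (a * x)) * Real.sin (a * x)) = 0 := by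
    intro p
    induction p using Polynomial.induction_on' with
    | add p q hp hq =>
      have hpc : Continuous fun x => p.eval (Real.cos (a * x)) := p.continuous.comp (by fun_prop)
      have hqc : Continuous fun x => q.eval (Real.cos (a * x)) := q.continuous.comp (by fun_prop)
      simp only [Polynomial.eval_add, add_mul, mul_add]
      rw [integral_add (hfc (by fun_prop)) (hfc (by fun_prop)), hp, hq, add_zero]
    | monomial n c =>
      have := hpow n 1
      simp only [Nat.cast_one, one_mul] at this
      simp only [Polynomial.eval_monomial]
      have e : ∀ x, f x * (c * Real.cos (a * x) ^ n * Real.sin (a * x))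
          = c * (f x * (Real.cos (a * x) ^ n * Real.sin (a * x))) := fun x => by ring
      simp_rw [e]
      rw [integral_const_mul, this, mul_zero]
  have hF : IntegrableOn (fun x => f x * Real.sin (a * x)) (Ioo 0 L) := hfc (by fun_prop)
  have hcont : ∀ g : ℝ → ℝ, Continuous g →
      ∫ x in Ioo 0 L, f x * (g x * Real.sin (a * x)) = 0 := by
    intro g hg
    set I := ∫ x in Ioo 0 L, |f x * Real.sin (a * x)| with hI
    have hI0 : 0 ≤ I := integral_nonneg fun _ => abs_nonneg _
    have hle : ∀ ε : ℝ, 0 < ε → |∫ x in Ioo 0 L, f x * (g x * Real.sin (a * x))| ≤ ε * I := by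
      intro ε hε
      -- in the variable `y = cos (ax)` the function `g` becomes `g (arccos y / a)`
      obtain ⟨p, hp⟩ := exists_polynomial_near_of_continuousOn (-1) 1
        (fun y => g (a⁻¹ * Real.arccos y))
        ((hg.comp (continuous_const.mul Real.continuous_arccos)).continuousOn) ε hε
      have hpc : Continuous fun x => p.eval (Real.cos (a * x)) := p.continuous.comp (by fun_prop)
      have e : ∫ x in Ioo 0 L, f x * (g x * Real.sin (a * x)) =
          ∫ x in Ioo 0 L, (g x - p.eval (Real.cos (a * x))) * (f x * Real.sin (a * x)) := by
        have h1 := integral_sub (hfc (g := fun x => g x * Real.sin (a * x)) (by fun_prop))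
          (hfc (g := fun x => p.eval (Real.cos (a * x)) * Real.sin (a * x)) (by fun_prop))
        rw [hpoly p, sub_zero] at h1
        rw [← h1]
        congr 1; ext x; ring
      rw [e, hI, ← integral_const_mul]
      refine (abs_integral_le_integral_abs).trans ?_
      refine setIntegral_mono_on ?_ (hF.abs.const_mul ε) measurableSet_Ioo fun x hx => ?_
      · refine ((hfc (g := fun x => (g x - p.eval (Real.cos (a * x))) * Real.sin (a * x))
          (by fun_prop)).congr (ae_of_all _ fun x => ?_)).abs
        ring
      · rw [abs_mul]
        gcongr
        have h1 := hp (Real.cos (a * x)) ⟨Real.neg_one_le_cos _, Real.cos_le_one _⟩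
        have h2 : a * x ≤ Real.pi := by
          rw [ha, div_mul_eq_mul_div, div_le_iff₀ hL]
          exact mul_le_mul_of_nonneg_left hx.2.le Real.pi_pos.le
        rw [Real.arccos_cos (mul_pos hapos hx.1).le h2, inv_mul_cancel_left₀ hapos.ne'] at h1
        rw [abs_sub_comm]
        exact h1.le
    have hz : |∫ x in Ioo 0 L, f x * (g x * Real.sin (a * x))| ≤ 0 := by
      refine le_of_forall_pos_le_add fun ε hε => ?_
      have := hle (ε / (I + 1)) (by positivity)
      refine this.trans ?_
      rw [zero_add, div_mul_eq_mul_div, div_le_iff₀ (by positivity)]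
      nlinarith
    exact abs_nonpos_iff.1 hz
  have hae := isOpen_Ioo.ae_eq_zero_of_integral_contDiff_smul_eq_zero (μ := volume)
    hF.locallyIntegrableOn (fun g hg hgc hgs => by
      refine Eq.trans ?_ (hcont g hg.continuous)
      rw [← integral_indicator measurableSet_Ioo]
      refine integral_congr_ae (ae_of_all _ fun x => ?_)
      by_cases hx : x ∈ Ioo 0 L
      · simp only [indicator, hx, if_true, smul_eq_mul]; ring
      · have : g x = 0 := image_eq_zero_of_notMem_tsupport fun hx' => hx (hgs hx')
        simp [indicator, hx, this])
  apply Lp.ext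
  rw [Filter.EventuallyEq, ae_restrict_iff' measurableSet_Ioo]
  have hzero : ∀ᵐ x ∂(volume : Measure ℝ), x ∈ Ioo 0 L → (0 : L2Interval L) x = 0 := by
    rw [← ae_restrict_iff' measurableSet_Ioo]
    exact Lp.coeFn_zero _ _ _
  filter_upwards [hae, hzero] with x hx h0 hxL
  rw [h0 hxL]
  refine (mul_eq_zero.1 (hx hxL)).resolve_right (Real.sin_pos_of_pos_of_lt_pi
    (mul_pos hapos hxL.1) ?_).ne'
  rw [ha, div_mul_eq_mul_div, div_lt_iff₀ hL]
  exact mul_lt_mul_of_pos_left hxL.2 Real.pi_pos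

/-- The sines as a Hilbert basis of `L²(0,L)`. -/
def sineBasis {L : ℝ} (hL : 0 < L) : HilbertBasis ℕ ℝ (L2Interval L) :=
  HilbertBasis.mkOfOrthogonalEqBot (orthonormal_sineLp hL) (by
    rw [Submodule.eq_bot_iff]
    intro f hf
    refine eq_zero_of_inner_sineLp hL f fun j => ?_
    rw [real_inner_comm]
    exact (Submodule.mem_orthogonal _ f).1 hf _ (Submodule.subset_span ⟨j, rfl⟩))

theorem sineBasis_apply {L : ℝ} (hL : 0 < L) (j : ℕ) : sineBasis hL j = sineLp L j := by
  rw [sineBasis, HilbertBasis.coe_mkOfOrthogonalEqBot]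

/-! ### Modes of the Neumann and Robin problems -/

/-- Green's formula for a smooth harmonic function with `∂ᵣu = 0` on the bottom: it solves the
Neumann problem with data `∂ᵣu` on `Γ`. -/
theorem form_ofSmooth_of_harmonic {L R : ℝ} (hL : 0 < L) (hR : 0 < R) {u : ℝ × ℝ → ℝ}
    (hu : ContDiff ℝ ∞ u)
    (hΔ : ∀ x, fderiv ℝ (fun y => fderiv ℝ u y (1, 0)) x (1, 0)
      = -fderiv ℝ (fun y => fderiv ℝ u y (0, 1)) x (0, 1))
    (hb : ∀ z, fderiv ℝ u (z, 0) (0, 1) = 0) {w : ℝ → ℝ} (hw : Continuous w)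
    (ht : ∀ z, fderiv ℝ u (z, R) (0, 1) = w z)
    (φ : H1Rect L R) (h0 : φ.trIn = 0) (h1 : φ.trOut = 0) :
    (H1Rect.ofSmooth hL hR u hu).form 0 φ = inner ℝ (L2Interval.ofCont L w hw) φ.trTop := by
  have g1 := φ.green_z_inner (contDiff_fderiv_apply hu (1, 0))
  have g2 := φ.green_r_inner (contDiff_fderiv_apply hu (0, 1))
  rw [h0, h1, inner_zero_left, inner_zero_left, sub_zero, add_zero] at g1
  simp only [hb, ht] at g2
  have hz : L2Interval.ofCont L (fun _ => 0) continuous_const = 0 := rfl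
  rw [hz, inner_zero_right, sub_zero] at g2
  have hs : L2Rect.ofCont L R _
      (continuous_fderiv_apply (contDiff_fderiv_apply hu (1, 0)) (1, 0)) =
      -L2Rect.ofCont L R _
        (continuous_fderiv_apply (contDiff_fderiv_apply hu (0, 1)) (0, 1)) := by
    simp only [hΔ]
    rfl
  rw [hs, inner_neg_right] at g1
  rw [H1Rect.form, zero_mul, add_zero, real_inner_comm φ.dz, real_inner_comm φ.dr,
    real_inner_comm φ.trTop]
  change inner ℝ φ.dz (L2Rect.ofCont L R _ (continuous_fderiv_apply hu (1, 0)))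
    + inner ℝ φ.dr (L2Rect.ofCont L R _ (continuous_fderiv_apply hu (0, 1))) = _
  linarith

theorem fderiv_mul_fst {a b : ℝ → ℝ} (ha : ContDiff ℝ ∞ a) (hb : ContDiff ℝ ∞ b) {a' : ℝ → ℝ}
    (h : ∀ x, HasDerivAt a (a' x) x) (x : ℝ × ℝ) :
    fderiv ℝ (fun y : ℝ × ℝ => a y.1 * b y.2) x (1, 0) = a' x.1 * b x.2 :=
  (hasDerivAt_fst ((ha.comp contDiff_fst).mul (hb.comp contDiff_snd)) x.1 x.2).unique
    ((h x.1).mul_const (b x.2))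

theorem fderiv_mul_snd {a b : ℝ → ℝ} (ha : ContDiff ℝ ∞ a) (hb : ContDiff ℝ ∞ b) {b' : ℝ → ℝ}
    (h : ∀ x, HasDerivAt b (b' x) x) (x : ℝ × ℝ) :
    fderiv ℝ (fun y : ℝ × ℝ => a y.1 * b y.2) x (0, 1) = a x.1 * b' x.2 :=
  (hasDerivAt_snd ((ha.comp contDiff_fst).mul (hb.comp contDiff_snd)) x.1 x.2).unique
    ((h x.2).const_mul (a x.1))

/-- Separation of variables: the solution with data `sin (kz)` is a multiple of
`sin (kz) cosh (kr)`. -/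
theorem exists_isNeumannSolution_sineLp (P : TestProblem) (j : ℕ) :
    ∃ u : H1Rect P.L P.R, IsNeumannSolution (sineLp P.L j) u ∧
      u.trTop = P.μ j • sineLp P.L j := by
  set k := freq P.L j with hk
  have hkpos : 0 < k := freq_pos P.L_pos j
  have hsh : 0 < Real.sinh (k * P.R) := Real.sinh_pos_iff.2 (mul_pos hkpos P.R_pos)
  let b : ℝ → ℝ := fun r => (k * Real.sinh (k * P.R))⁻¹ * Real.cosh (k * r)
  let b' : ℝ → ℝ := fun r => (Real.sinh (k * P.R))⁻¹ * Real.sinh (k * r)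
  have hbs : ContDiff ℝ ∞ b :=
    contDiff_const.mul (Real.contDiff_cosh.comp (contDiff_const.mul contDiff_id))
  have hbs' : ContDiff ℝ ∞ b' :=
    contDiff_const.mul (Real.contDiff_sinh.comp (contDiff_const.mul contDiff_id))
  have hb : ∀ r, HasDerivAt b (b' r) r := by
    intro r
    refine ((((hasDerivAt_id r).const_mul k).cosh).const_mul
      (k * Real.sinh (k * P.R))⁻¹).congr_deriv ?_
    simp only [b', id, mul_one]
    field_simp
  have hb' : ∀ r, HasDerivAt b' (k ^ 2 * b r) r := by
    intro r
    refine ((((hasDerivAt_id r).const_mul k).sinh).const_mul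
      (Real.sinh (k * P.R))⁻¹).congr_deriv ?_
    simp only [b, id, mul_one]
    field_simp
  have hbc := hbs.continuous
  have hs := contDiff_sineMode P.L j
  have hsc := hs.continuous
  have hc := contDiff_cosineMode P.L j
  have hu : ContDiff ℝ ∞ fun x : ℝ × ℝ => sineMode P.L j x.1 * b x.2 :=
    (hs.comp contDiff_fst).mul (hbs.comp contDiff_snd)
  have hdz := fderiv_mul_fst hs hbs (hasDerivAt_sineMode P.L j)
  have hdr := fderiv_mul_snd hs hbs hb
  refine ⟨H1Rect.ofSmooth P.L_pos P.R_pos _ hu, isNeumannSolution_iff.2 ⟨?_, ?_,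
    form_ofSmooth_of_harmonic P.L_pos P.R_pos hu (fun x => ?_) (fun z => ?_) _ (fun z => ?_)⟩, ?_⟩
  · change L2Interval.ofCont P.R (fun r => sineMode P.L j 0 * b r) (by fun_prop) = 0
    simp only [sineMode_zero, zero_mul]
    rfl
  · change L2Interval.ofCont P.R (fun r => sineMode P.L j P.L * b r) (by fun_prop) = 0
    simp only [sineMode_end P.L_pos, zero_mul]
    rfl
  · simp only [hdz, hdr]
    rw [fderiv_mul_fst hc hbs (hasDerivAt_cosineMode P.L j), fderiv_mul_snd hs hbs' hb']
    ring
  · rw [hdr]; simp [b']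
  · rw [hdr]; simp [b', hsh.ne']
  · have hμ : P.μ j = b P.R := by
      have h1 : k * P.R = ((j : ℝ) + 1) * Real.pi * P.R / P.L := by rw [hk, freq]; ring
      have h2 : k * P.L = ((j : ℝ) + 1) * Real.pi := by
        rw [hk, freq_mul_self P.L_pos]; push_cast; ring
      have h3 := P.L_pos.ne'
      have h4 := (Real.cosh_pos (k * P.R)).ne'
      rw [TestProblem.μ, ← h1, ← h2, Real.tanh_eq_sinh_div_cosh]
      simp only [b]
      field_simp
    change L2Interval.ofCont P.L (fun z => sineMode P.L j z * b P.R) (by fun_prop) = _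
    simp only [← hμ, mul_comm _ (P.μ j)]
    rfl

/-- A Neumann solution with data `w` solves the Robin problem with data `u|_Γ + κ w`. -/
theorem IsNeumannSolution.isRobinSolution {L R κ : ℝ} (hκ : κ ≠ 0) {w : L2Interval L}
    {u : H1Rect L R} (hu : IsNeumannSolution w u) :
    IsRobinSolution κ 0 0 (u.trTop + κ • w) u := by
  refine ⟨hu.1, hu.2.1, fun φ h0 h1 => ?_⟩
  rw [hu.2.2 φ h0 h1, inner_add_left, real_inner_smul_left, mul_add, inv_mul_cancel_left₀ hκ,
    add_comm]

section
variable {P : TestProblem} {S M : L2Interval P.L →L[ℝ] L2Interval P.L}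

theorem IsRobinTraceOperator.apply_eq (hS : IsRobinTraceOperator P S) {w : L2Interval P.L}
    {u : H1Rect P.L P.R} (hu : IsRobinSolution P.κ 0 0 w u) : S w = u.trTop := by
  obtain ⟨v, hv, h⟩ := hS w
  rw [h, IsRobinSolution.unique P hu hv]

theorem IsAddedMassOperator.apply_eq (hM : IsAddedMassOperator P M) {w : L2Interval P.L}
    {u : H1Rect P.L P.R} (hu : IsNeumannSolution w u) : M w = u.trTop := by
  obtain ⟨v, hv, h⟩ := hM w
  rw [h, IsNeumannSolution.unique P hu hv]

theorem H1Rect.form_comm {L R c : ℝ} (u v : H1Rect L R) : u.form c v = v.form c u := by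
  simp only [H1Rect.form, real_inner_comm]

/-- Symmetry comes from testing each of the two Robin problems with the solution of the other. -/
theorem IsRobinTraceOperator.symmetric (hS : IsRobinTraceOperator P S) (v w : L2Interval P.L) :
    inner ℝ (S v) w = inner ℝ v (S w) := by
  obtain ⟨a, ha, h1⟩ := hS v
  obtain ⟨b, hb, h2⟩ := hS w
  have e1 := (isRobinSolution_iff.1 ha).2.2 b hb.1 hb.2.1
  have e2 := (isRobinSolution_iff.1 hb).2.2 a ha.1 ha.2.1
  rw [H1Rect.form_comm, e2] at e1
  rw [h1, h2, real_inner_comm]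
  exact mul_left_cancel₀ (inv_ne_zero P.κ_pos.ne') e1

theorem IsAddedMassOperator.symmetric (hM : IsAddedMassOperator P M) (v w : L2Interval P.L) :
    inner ℝ (M v) w = inner ℝ v (M w) := by
  obtain ⟨a, ha, h1⟩ := hM v
  obtain ⟨b, hb, h2⟩ := hM w
  have e1 := (isNeumannSolution_iff.1 ha).2.2 b hb.1 hb.2.1
  have e2 := (isNeumannSolution_iff.1 hb).2.2 a ha.1 ha.2.1
  rw [H1Rect.form_comm, e2] at e1
  rw [h1, h2, real_inner_comm]
  exact e1

theorem TestProblem.μ_pos (P : TestProblem) (j : ℕ) : 0 < P.μ j := by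
  have h1 := P.L_pos
  have h2 := P.R_pos
  have h3 := Real.pi_pos
  have : 0 < Real.tanh (((j : ℝ) + 1) * Real.pi * P.R / P.L) := by
    rw [Real.tanh_eq_sinh_div_cosh]
    exact div_pos (Real.sinh_pos_iff.2 (by positivity)) (Real.cosh_pos _)
  unfold TestProblem.μ
  positivity

theorem tanh_le_tanh {x y : ℝ} (h : x ≤ y) : Real.tanh x ≤ Real.tanh y := by
  rw [Real.tanh_eq_sinh_div_cosh, Real.tanh_eq_sinh_div_cosh,
    div_le_div_iff₀ (Real.cosh_pos _) (Real.cosh_pos _)]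
  have := Real.sinh_nonneg_iff.2 (sub_nonneg.2 h)
  rw [Real.sinh_sub] at this
  linarith

theorem TestProblem.μ_le (P : TestProblem) (j : ℕ) : P.μ j ≤ P.μ 0 := by
  have h1 := P.L_pos
  have h2 := P.R_pos
  have h3 := Real.pi_pos
  have h4 : ((0 : ℕ) : ℝ) + 1 ≤ (j : ℝ) + 1 := by simp
  have h5 : 0 < Real.tanh ((((0 : ℕ) : ℝ) + 1) * Real.pi * P.R / P.L) := by
    rw [Real.tanh_eq_sinh_div_cosh]
    exact div_pos (Real.sinh_pos_iff.2 (by positivity)) (Real.cosh_pos _)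
  unfold TestProblem.μ
  have h6 : Real.tanh ((((0 : ℕ) : ℝ) + 1) * Real.pi * P.R / P.L) ≤
      Real.tanh (((j : ℝ) + 1) * Real.pi * P.R / P.L) := tanh_le_tanh (by gcongr)
  gcongr

theorem TestProblem.lam_pos (P : TestProblem) (j : ℕ) : 0 < P.lam j :=
  div_pos (P.μ_pos j) (add_pos (P.μ_pos j) P.κ_pos)

theorem TestProblem.lam_lt_one (P : TestProblem) (j : ℕ) : P.lam j < 1 := by
  rw [TestProblem.lam, div_lt_one (add_pos (P.μ_pos j) P.κ_pos)]
  linarith [P.κ_pos]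

theorem TestProblem.lam_le (P : TestProblem) (j : ℕ) : P.lam j ≤ P.lam 0 := by
  rw [TestProblem.lam, TestProblem.lam,
    div_le_div_iff₀ (add_pos (P.μ_pos j) P.κ_pos) (add_pos (P.μ_pos 0) P.κ_pos)]
  nlinarith [P.κ_pos, P.μ_le j]

theorem IsAddedMassOperator.apply_sineLp (hM : IsAddedMassOperator P M) (j : ℕ) :
    M (sineLp P.L j) = P.μ j • sineLp P.L j := by
  obtain ⟨u, hu, ht⟩ := exists_isNeumannSolution_sineLp P j
  rw [hM.apply_eq hu, ht]

theorem IsRobinTraceOperator.apply_sineLp (hS : IsRobinTraceOperator P S) (j : ℕ) :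
    S (sineLp P.L j) = P.lam j • sineLp P.L j := by
  obtain ⟨u, hu, ht⟩ := exists_isNeumannSolution_sineLp P j
  have h := hS.apply_eq (hu.isRobinSolution P.κ_pos.ne')
  have hpos : P.μ j + P.κ ≠ 0 := (add_pos (P.μ_pos j) P.κ_pos).ne'
  rw [ht, ← add_smul, map_smul] at h
  rw [TestProblem.lam, div_eq_inv_mul, mul_smul, ← h, inv_smul_smul₀ hpos]

end

/-- A symmetric operator that is diagonal in a Hilbert basis has no other eigenvalues than its
diagonal entries. -/
theorem hasEigenvalue_iff_of_hilbertBasis {X : Type*} [NormedAddCommGroup X]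
    [InnerProductSpace ℝ X] (z : HilbertBasis ℕ ℝ X) (T : X →L[ℝ] X)
    (hT : ∀ v w, inner ℝ (T v) w = inner ℝ v (T w)) {m : ℕ → ℝ} (h : ∀ j, T (z j) = m j • z j)
    (l : ℝ) : Module.End.HasEigenvalue T.toLinearMap l ↔ ∃ j, l = m j := by
  constructor
  · intro hl
    obtain ⟨v, hv⟩ := hl.exists_hasEigenvector
    have hTv : T v = l • v := hv.apply_eq_smul
    by_contra hne
    push Not at hne
    refine hv.2 (z.repr.injective ?_)
    rw [map_zero]
    ext j
    rw [z.repr_apply_apply]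
    have h1 := hT (z j) v
    rw [h, hTv, real_inner_smul_left, real_inner_smul_right] at h1
    have h2 : (m j - l) * inner ℝ (z j) v = 0 := by linarith
    simpa using (mul_eq_zero.1 h2).resolve_left (sub_ne_zero.2 (hne j).symm)
  · rintro ⟨j, rfl⟩
    refine Module.End.hasEigenvalue_of_hasEigenvector (x := z j) ⟨?_, ?_⟩
    · exact Module.End.mem_eigenspace_iff.2 (h j)
    · exact z.orthonormal.ne_zero j

/-! ### The space `H¹₀` and the structure sub-problem -/

theorem continuous_deriv_of_contDiff {φ : ℝ → ℝ} (hφ : ContDiff ℝ ∞ φ) : Continuous (deriv φ) :=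
  hφ.continuous_deriv (by simp)

namespace H10
variable {L : ℝ}

theorem green_inner (q : H10 L) {φ : ℝ → ℝ} (hφ : ContDiff ℝ ∞ φ) :
    inner ℝ q.val (L2Interval.ofCont L _ (continuous_deriv_of_contDiff hφ)) =
      -inner ℝ q.dx (L2Interval.ofCont L φ hφ.continuous) := by
  simp only [L2Interval.inner_ofCont]
  exact q.green φ hφ

/-- An element of `H¹₀` from Green's formula written with the inner product of `L²`. -/
def ofInner (val dx : L2Interval L) (h : ∀ (φ : ℝ → ℝ) (hφ : ContDiff ℝ ∞ φ),
    inner ℝ val (L2Interval.ofCont L _ (continuous_deriv_of_contDiff hφ)) =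
      -inner ℝ dx (L2Interval.ofCont L φ hφ.continuous)) : H10 L where
  val := val
  dx := dx
  green φ hφ := by simpa only [L2Interval.inner_ofCont] using h φ hφ

/-- The linear combination `a u + b v`. -/
def lin (a b : ℝ) (u v : H10 L) : H10 L :=
  ofInner (a • u.val + b • v.val) (a • u.dx + b • v.dx) fun φ hφ => by
    simp only [inner_add_left, real_inner_smul_left, u.green_inner hφ, v.green_inner hφ]
    ring

@[simp] theorem lin_val (a b : ℝ) (u v : H10 L) : (lin a b u v).val = a • u.val + b • v.val := rfl
@[simp] theorem lin_dx (a b : ℝ) (u v : H10 L) : (lin a b u v).dx = a • u.dx + b • v.dx := rfl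

/-- The `j`-th sine as an element of `H¹₀`. -/
def sine (hL : 0 < L) (j : ℕ) : H10 L :=
  ofInner (sineLp L j) (L2Interval.ofCont L (cosineMode L j) (contDiff_cosineMode L j).continuous)
    fun φ hφ => by
      have hd := continuous_deriv_of_contDiff hφ
      have hc := hφ.continuous
      have h1 := continuous_sineMode L j
      have h2 := (contDiff_cosineMode L j).continuous
      have hI := integral_Ioo_of_hasDerivAt hL
        (fun x => (hasDerivAt_sineMode L j x).mul ((hφ.differentiable (by simp) x).hasDerivAt))
        (by fun_prop)
      rw [integral_add (integrableOn_Ioo_of_continuous (by fun_prop))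
        (integrableOn_Ioo_of_continuous (by fun_prop))] at hI
      simp only [Pi.mul_apply, sineMode_zero, sineMode_end hL, zero_mul, sub_zero] at hI
      rw [sineLp, L2Interval.inner_ofCont_ofCont, L2Interval.inner_ofCont_ofCont]
      linarith

theorem inner_dx_sine (hL : 0 < L) (q : H10 L) (j : ℕ) :
    inner ℝ q.dx (sine hL j).dx = freq L j ^ 2 * inner ℝ q.val (sineLp L j) := by
  have h := q.green_inner (contDiff_cosineMode L j)
  have hd : deriv (cosineMode L j) = fun x => -(freq L j) ^ 2 * sineMode L j x :=
    funext fun x => (hasDerivAt_cosineMode L j x).deriv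
  simp only [hd] at h
  have e : L2Interval.ofCont L (fun x => -(freq L j) ^ 2 * sineMode L j x)
      (continuous_const.mul (continuous_sineMode L j)) = (-(freq L j) ^ 2) • sineLp L j := rfl
  rw [e, real_inner_smul_right] at h
  change inner ℝ q.dx (L2Interval.ofCont L (cosineMode L j)
    (contDiff_cosineMode L j).continuous) = _
  linarith

end H10

/-- `H¹₀(0,L)` as a closed subspace of the pairs `(val, dx)`. -/
def H10Space (L : ℝ) : Submodule ℝ (WithLp 2 (L2Interval L × L2Interval L)) where
  carrier := {x | ∀ (φ : ℝ → ℝ) (hφ : ContDiff ℝ ∞ φ),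
    inner ℝ x.fst (L2Interval.ofCont L _ (continuous_deriv_of_contDiff hφ)) =
      -inner ℝ x.snd (L2Interval.ofCont L φ hφ.continuous)}
  add_mem' := by
    rintro x y hx hy φ hφ
    simp only [WithLp.add_fst, WithLp.add_snd, inner_add_left, hx φ hφ, hy φ hφ]; ring
  zero_mem' := by simp
  smul_mem' := by
    rintro c x hx φ hφ
    simp only [WithLp.smul_fst, WithLp.smul_snd, real_inner_smul_left, hx φ hφ]; ring

theorem isClosed_H10Space (L : ℝ) :
    IsClosed (H10Space L : Set (WithLp 2 (L2Interval L × L2Interval L))) := by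
  have c1 : Continuous fun x : WithLp 2 (L2Interval L × L2Interval L) => x.fst :=
    WithLp.continuous_fst ..
  have c2 : Continuous fun x : WithLp 2 (L2Interval L × L2Interval L) => x.snd :=
    WithLp.continuous_snd ..
  change IsClosed {x : WithLp 2 (L2Interval L × L2Interval L) |
    ∀ (φ : ℝ → ℝ) (hφ : ContDiff ℝ ∞ φ),
      inner ℝ x.fst (L2Interval.ofCont L _ (continuous_deriv_of_contDiff hφ)) =
        -inner ℝ x.snd (L2Interval.ofCont L φ hφ.continuous)}
  simp only [ofPred_forall]
  refine isClosed_iInter fun φ => isClosed_iInter fun hφ => isClosed_eq ?_ ?_ <;> fun_prop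

instance (L : ℝ) : CompleteSpace (H10Space L) :=
  (isClosed_H10Space L).completeSpace_coe

/-- Elliptic problems on `H¹₀` with zeroth and first order terms. -/
theorem H10.existsUnique_elliptic {L α γ : ℝ} (hα : 0 < α) (hγ : 0 < γ) (f g : L2Interval L) :
    ∃! u : H10 L, ∀ ξ : H10 L, α * inner ℝ u.val ξ.val + γ * inner ℝ u.dx ξ.dx =
      inner ℝ f ξ.val + inner ℝ g ξ.dx := by
  have hα' := Real.mul_self_sqrt hα.le
  have hγ' := Real.mul_self_sqrt hγ.le
  have hα0 : √α ≠ 0 := (Real.sqrt_pos.2 hα).ne'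
  have hγ0 : √γ ≠ 0 := (Real.sqrt_pos.2 hγ).ne'
  let V : H10Space L →L[ℝ] L2Interval L := (WithLp.fstL 2 ℝ _ _) ∘L (H10Space L).subtypeL
  let D : H10Space L →L[ℝ] L2Interval L := (WithLp.sndL 2 ℝ _ _) ∘L (H10Space L).subtypeL
  obtain ⟨u, hu⟩ := (exists_represent_of_coercive (V := H10Space L) (√α • V) (√γ • D) V
    (c := 0) le_rfl (k := min α γ) (lt_min hα hγ) (fun v => by
      rw [Submodule.coe_norm, WithLp.prod_norm_sq_eq_of_L2]
      change _ ≤ ‖√α • V v‖ ^ 2 + ‖√γ • D v‖ ^ 2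
      rw [norm_smul, norm_smul, mul_pow, mul_pow, Real.norm_eq_abs, Real.norm_eq_abs, sq_abs,
        sq_abs, Real.sq_sqrt hα.le, Real.sq_sqrt hγ.le, mul_add]
      exact add_le_add (mul_le_mul_of_nonneg_right (min_le_left _ _) (sq_nonneg _))
        (mul_le_mul_of_nonneg_right (min_le_right _ _) (sq_nonneg _)))).1
    ((√α)⁻¹ • f) ((√γ)⁻¹ • g) 0
  have h : ∀ ξ : H10 L, α * inner ℝ (V u) ξ.val + γ * inner ℝ (D u) ξ.dx =
      inner ℝ f ξ.val + inner ℝ g ξ.dx := by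
    intro ξ
    have h : inner ℝ (√α • V u) (√α • ξ.val) + inner ℝ (√γ • D u) (√γ • ξ.dx)
        + 0 * inner ℝ (V u) ξ.val = inner ℝ ((√α)⁻¹ • f) (√α • ξ.val)
        + inner ℝ ((√γ)⁻¹ • g) (√γ • ξ.dx) + inner ℝ 0 ξ.val :=
      hu ⟨WithLp.toLp 2 (ξ.val, ξ.dx), fun φ hφ => ξ.green_inner hφ⟩
    simp only [real_inner_smul_left, real_inner_smul_right, inner_zero_left, zero_mul, add_zero,
      ← mul_assoc, hα', hγ', one_mul, mul_inv_cancel₀ hα0, mul_inv_cancel₀ hγ0] at h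
    exact h
  refine ⟨H10.ofInner (V u) (D u) u.2, h, fun v hv => ?_⟩
  · set q : H10 L := H10.lin 1 (-1) v (H10.ofInner (V u) (D u) u.2) with hq
    have e1 : q.val = v.val - V u := by
      rw [hq, H10.lin_val, one_smul, neg_one_smul, ← sub_eq_add_neg]; rfl
    have e2 : q.dx = v.dx - D u := by
      rw [hq, H10.lin_dx, one_smul, neg_one_smul, ← sub_eq_add_neg]; rfl
    have h2 : α * ‖q.val‖ ^ 2 + γ * ‖q.dx‖ ^ 2 = 0 := by
      have h3 : α * inner ℝ (v.val - V u) q.val + γ * inner ℝ (v.dx - D u) q.dx = 0 := by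
        rw [inner_sub_left, inner_sub_left]
        linarith [hv q, h q]
      rwa [← e1, ← e2, real_inner_self_eq_norm_sq, real_inner_self_eq_norm_sq] at h3
    have p1 : 0 ≤ α * ‖q.val‖ ^ 2 := by positivity
    have p2 : 0 ≤ γ * ‖q.dx‖ ^ 2 := by positivity
    have h4 : q.val = 0 := by
      have : α * ‖q.val‖ ^ 2 = 0 := by linarith
      simpa [hα.ne'] using this
    have h5 : q.dx = 0 := by
      have : γ * ‖q.dx‖ ^ 2 = 0 := by linarith
      simpa [hγ.ne'] using this
    exact H10.ext (sub_eq_zero.1 (e1 ▸ h4)) (sub_eq_zero.1 (e2 ▸ h5))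

/-- The equation of one time step of the structure sub-problem, with load `F` on `Γ`. -/
def IsStructureStep (P : TestProblem) (θ dt : ℝ) (F : L2Interval P.L) (a b e : H10 P.L) : Prop :=
  ∀ ξ : H10 P.L,
    P.ρs * P.h / dt ^ 2 * inner ℝ (e.val - (2 : ℝ) • b.val + a.val) ξ.val
      + (P.C₀ * inner ℝ (θ • e.val + (1 - 2 * θ) • b.val + θ • a.val) ξ.val
        + P.C₁ * inner ℝ (θ • e.dx + (1 - 2 * θ) • b.dx + θ • a.dx) ξ.dx)
      = inner ℝ F ξ.val

theorem structureSteps_iff {P : TestProblem} {β θ dt : ℝ} {p : ℕ → H1Rect P.L P.R}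
    {η : ℕ → H10 P.L} : StructureSteps P β θ dt p η ↔
      ∀ n, IsStructureStep P θ dt (β • (p (n + 2)).trTop) (η n) (η (n + 1)) (η (n + 2)) := by
  simp only [StructureSteps, IsStructureStep, real_inner_smul_left _ _ β]

theorem existsUnique_isStructureStep (P : TestProblem) {θ dt : ℝ} (hθ : 0 < θ) (hdt : 0 < dt)
    (F : L2Interval P.L) (a b : H10 P.L) : ∃! e, IsStructureStep P θ dt F a b e := by
  have h1 := P.ρs_pos
  have h2 := P.h_pos
  have h3 := P.C₀_pos
  have h4 := P.C₁_pos
  set m := P.ρs * P.h / dt ^ 2 with hm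
  refine (existsUnique_congr fun e => ?_).1 (H10.existsUnique_elliptic
    (α := m + P.C₀ * θ) (γ := P.C₁ * θ) (by positivity) (by positivity)
    (F + m • ((2 : ℝ) • b.val - a.val) - P.C₀ • ((1 - 2 * θ) • b.val + θ • a.val))
    (-(P.C₁ • ((1 - 2 * θ) • b.dx + θ • a.dx))))
  refine forall_congr' fun ξ => ?_
  rw [← hm]
  simp only [inner_add_left, inner_sub_left, inner_neg_left, real_inner_smul_left]
  constructor <;> intro h <;> linarith

theorem existsUnique_seq {α : Type*} (r : ℕ → α → α → Prop) (h : ∀ n a, ∃! b, r n a b) (a₀ : α) :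
    ∃! s : ℕ → α, s 0 = a₀ ∧ ∀ n, r n (s n) (s (n + 1)) := by
  choose f hf hu using h
  refine ⟨fun n => Nat.rec a₀ (fun n a => f n a) n, ⟨rfl, fun n => hf n _⟩, fun s hs => ?_⟩
  funext n
  induction n with
  | zero => exact hs.1
  | succ n ih =>
    have := hu n _ _ (hs.2 n)
    rw [this, ih]

theorem existsUnique_seq_two {α : Type*} (r : ℕ → α → α → α → Prop)
    (h : ∀ n a b, ∃! c, r n a b c) (a₀ a₁ : α) :
    ∃! s : ℕ → α, s 0 = a₀ ∧ s 1 = a₁ ∧ ∀ n, r n (s n) (s (n + 1)) (s (n + 2)) := by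
  obtain ⟨s, ⟨h0, hs⟩, hu⟩ := existsUnique_seq
    (fun n (x y : α × α) => y.1 = x.2 ∧ r n x.1 x.2 y.2) (fun n x => by
      obtain ⟨c, hc, hcu⟩ := h n x.1 x.2
      refine ⟨(x.2, c), ⟨rfl, hc⟩, ?_⟩
      rintro ⟨y1, y2⟩ ⟨hy1, hy2⟩
      exact Prod.ext hy1 (hcu _ hy2)) (a₀, a₁)
  have h1 : ∀ n, (s (n + 1)).1 = (s n).2 := fun n => (hs n).1
  refine ⟨fun n => (s n).1, ⟨by simp [h0], by simp [h1, h0], fun n => ?_⟩, fun t ht => ?_⟩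
  · have := (hs n).2
    simp only [h1]
    exact this
  · have := hu (fun n => (t n, t (n + 1))) ⟨by simp [ht.1, ht.2.1], fun n => ⟨rfl, ht.2.2 n⟩⟩
    funext n
    rw [← this]

theorem existsUnique_scheme (P : TestProblem) {β θ dt : ℝ} (hθ : 0 < θ) (hdt : 0 < dt)
    {pIn pOut : ℝ → L2Interval P.R} (h : ∀ t, 0 ≤ t → ∃ M, InOutNormLE P.L P.R (pIn t) (pOut t) M)
    (p0 : H1Rect P.L P.R) (η0 η1 : H10 P.L) :
    ∃! s : (ℕ → H1Rect P.L P.R) × (ℕ → H10 P.L),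
      s.1 0 = p0 ∧ s.2 0 = η0 ∧ s.2 1 = η1 ∧
      FluidSteps P β dt pIn pOut s.1 ∧ StructureSteps P β θ dt s.1 s.2 := by
  obtain ⟨p, ⟨hp0, hp⟩, hpu⟩ := existsUnique_seq
    (fun n (a b : H1Rect P.L P.R) => IsRobinSolution P.κ (pIn (((n : ℝ) + 1) * dt))
      (pOut (((n : ℝ) + 1) * dt)) (β • a.trTop) b)
    (fun n a => existsUnique_isRobinSolution P _ (h _ (by positivity))) p0
  obtain ⟨η, ⟨hη0, hη1, hη⟩, hηu⟩ := existsUnique_seq_two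
    (fun n a b c => IsStructureStep P θ dt (β • (p (n + 2)).trTop) a b c)
    (fun n a b => existsUnique_isStructureStep P hθ hdt _ a b) η0 η1
  refine ⟨(p, η), ⟨hp0, hη0, hη1, hp, structureSteps_iff.2 hη⟩, ?_⟩
  rintro ⟨p', η'⟩ ⟨h1, h2, h3, h4, h5⟩
  obtain rfl : p' = p := hpu p' ⟨h1, h4⟩
  obtain rfl : η' = η := hηu η' ⟨h2, h3, structureSteps_iff.1 h5⟩
  rfl

/-- Testing with a sine decouples the structure step. -/
theorem StructureSteps.modalSteps {P : TestProblem} {β θ dt : ℝ} {p : ℕ → H1Rect P.L P.R}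
    {η : ℕ → H10 P.L} (h : StructureSteps P β θ dt p η) (j : ℕ) :
    ModalSteps P θ dt (P.ell j) (fun n => β * inner ℝ (sineLp P.L j) (p n).trTop)
      (fun n => inner ℝ (sineLp P.L j) (η n).val) := by
  intro n
  have h1 := h n (H10.sine P.L_pos j)
  have hv : (H10.sine P.L_pos j).val = sineLp P.L j := rfl
  simp only [inner_add_left, inner_sub_left, real_inner_smul_left, H10.inner_dx_sine, hv] at h1
  simp only [real_inner_comm _ (sineLp P.L j), TestProblem.ell]
  rw [← h1, freq]
  ring

/-! ### The pressure recursion -/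

/-- By linearity, the trace splits into the part due to the inlet and outlet pressures and the part
due to the data on `Γ`. -/
theorem IsRobinTraceOperator.trTop_eq {P : TestProblem} {S : L2Interval P.L →L[ℝ] L2Interval P.L}
    (hS : IsRobinTraceOperator P S) {gIn gOut : L2Interval P.R} {w : L2Interval P.L}
    {u q : H1Rect P.L P.R} (hu : IsRobinSolution P.κ gIn gOut w u)
    (hq : IsRobinSolution P.κ gIn gOut 0 q) : u.trTop = q.trTop + S w := by
  have h := hu.lin hq 1 (-1)
  simp only [one_smul, neg_one_smul, add_neg_cancel, neg_zero, add_zero] at h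
  rw [hS.apply_eq h, H1Rect.lin_trTop, one_smul, neg_one_smul]
  abel

theorem eq_sum_of_linear_recursion {x y : ℕ → ℝ} {β l : ℝ}
    (h : ∀ n, x (n + 1) = y (n + 1) + l * (β * x n)) (n : ℕ) :
    β * x (n + 1) = (∑ i ∈ Finset.range (n + 1), β ^ (i + 1) * l ^ i * y (n + 1 - i))
      + β ^ (n + 2) * l ^ (n + 1) * x 0 := by
  induction n with
  | zero => simp [h 0]; ring
  | succ n ih =>
    rw [h (n + 1), ih, Finset.sum_range_succ' _ (n + 1), mul_add, mul_add, mul_add,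
      Finset.mul_sum, Finset.mul_sum]
    have : ∀ i ∈ Finset.range (n + 1), β * (l * (β ^ (i + 1) * l ^ i * y (n + 1 - i))) =
        β ^ (i + 1 + 1) * l ^ (i + 1) * y (n + 1 + 1 - (i + 1)) := by
      intro i _
      rw [Nat.add_sub_add_right]; ring
    rw [Finset.sum_congr rfl this]
    simp only [Nat.sub_zero]
    ring

theorem summable_geometric_mul_bounded {β l : ℝ} (hβ0 : 0 ≤ β) (hβ1 : β ≤ 1) (hl0 : 0 ≤ l)
    (hl1 : l < 1) {b : ℕ → ℝ} {K : ℝ} (hK : ∀ i, |b i| ≤ K) :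
    Summable fun i : ℕ => β ^ (i + 1) * l ^ i * b i := by
  refine Summable.of_norm_bounded ((summable_geometric_of_lt_one hl0 hl1).mul_right K) fun i => ?_
  rw [Real.norm_eq_abs, abs_mul, abs_of_nonneg (by positivity)]
  gcongr
  · exact mul_le_of_le_one_left (by positivity) (pow_le_one₀ hβ0 hβ1)
  · exact hK i

theorem tendsto_zero_of_contraction {d e : ℕ → ℝ} {a : ℝ} (ha0 : 0 ≤ a) (ha1 : a < 1)
    (h : ∀ n, |d (n + 1)| ≤ a * |d n| + |e (n + 1)|) (he : Tendsto e atTop (𝓝 0)) :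
    Tendsto d atTop (𝓝 0) := by
  rw [Metric.tendsto_atTop]
  intro ε hε
  have hpos : 0 < 1 - a := by linarith
  obtain ⟨N, hN⟩ := Metric.tendsto_atTop.1 he (ε / 2 * (1 - a)) (by positivity)
  have hk : ∀ k, |d (N + k)| ≤ a ^ k * |d N| + ε / 2 := by
    intro k
    induction k with
    | zero => simpa using (by positivity : (0 : ℝ) ≤ ε / 2)
    | succ k ih =>
      have h1 := hN (N + k + 1) (by lia)
      rw [Real.dist_eq, sub_zero] at h1
      have h2 := mul_le_mul_of_nonneg_left ih ha0
      have h3 := h (N + k)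
      rw [← add_assoc, pow_succ]
      linarith
  have hlim : Tendsto (fun k => a ^ k * |d N|) atTop (𝓝 (0 * |d N|)) :=
    (tendsto_pow_atTop_nhds_zero_of_lt_one ha0 ha1).mul_const _
  rw [zero_mul] at hlim
  obtain ⟨K, hK⟩ := Metric.tendsto_atTop.1 hlim (ε / 2) (by positivity)
  refine ⟨N + K, fun n hn => ?_⟩
  obtain ⟨k, rfl⟩ := Nat.exists_eq_add_of_le (le_trans (Nat.le_add_right N K) hn)
  have h1 := hK k (by lia)
  rw [Real.dist_eq, sub_zero] at h1 ⊢
  linarith [hk k, le_abs_self (a ^ k * |d N|)]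

theorem tendsto_of_linear_recursion {x y : ℕ → ℝ} {β l c : ℝ} (hβ0 : 0 ≤ β) (hβ1 : β ≤ 1)
    (hl0 : 0 ≤ l) (hl1 : l < 1) (h : ∀ n, x (n + 1) = y (n + 1) + l * (β * x n))
    (hy : Tendsto y atTop (𝓝 c)) :
    Tendsto (fun n => β * x n) atTop (𝓝 (∑' i : ℕ, β ^ (i + 1) * l ^ i * c)) := by
  have ha0 : 0 ≤ l * β := mul_nonneg hl0 hβ0
  have ha1 : l * β < 1 := (mul_le_of_le_one_right hl0 hβ1).trans_lt hl1
  have hne : 1 - l * β ≠ 0 := by linarith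
  have hsum : ∑' i : ℕ, β ^ (i + 1) * l ^ i * c = β * ((1 - l * β)⁻¹ * c) := by
    rw [← tsum_geometric_of_lt_one ha0 ha1, ← tsum_mul_right, ← tsum_mul_left]
    congr 1; ext i; rw [mul_pow]; ring
  rw [hsum]
  refine Tendsto.const_mul β (tendsto_sub_nhds_zero_iff.1 ?_)
  refine tendsto_zero_of_contraction (e := fun n => y n - c) ha0 ha1 (fun n => ?_)
    (tendsto_sub_nhds_zero_iff.2 hy)
  have e : x (n + 1) - (1 - l * β)⁻¹ * c
      = l * β * (x n - (1 - l * β)⁻¹ * c) + (y (n + 1) - c) := by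
    rw [h n]; field_simp; ring
  rw [e]
  refine (abs_add_le _ _).trans_eq ?_
  rw [abs_mul, abs_of_nonneg ha0]

/-! ### Uniform bounds for the pressure -/

theorem le_of_sq_le_mul_self {t s : ℝ} (ht : 0 ≤ t) (hs : 0 ≤ s) (h : t ^ 2 ≤ s * t) : t ≤ s := by
  rcases ht.eq_or_lt with rfl | ht'
  · exact hs
  · rw [sq] at h; exact le_of_mul_le_mul_right h ht'

/-- The Robin-to-Dirichlet map is a strict contraction, with a factor that depends on the trace
constant of `Q` and on `κ` only. -/
theorem exists_contraction_factor (P : TestProblem) : ∃ ρ : ℝ, 0 ≤ ρ ∧ ρ < 1 ∧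
    ∀ (w : L2Interval P.L) (u : H1Rect P.L P.R), IsRobinSolution P.κ 0 0 w u →
      ‖u.trTop‖ ≤ ρ * ‖w‖ := by
  obtain ⟨K, hK, hbd⟩ := H1Rect.exists_gradient_bound P.L_pos P.R_pos
  have hκ := P.κ_pos
  refine ⟨K / (K + P.κ), by positivity, (div_lt_one (by positivity)).2 (by linarith),
    fun w u hu => ?_⟩
  have h1 := (isRobinSolution_iff.1 hu).2.2 u hu.1 hu.2.1
  obtain ⟨-, h2, -⟩ := hbd u hu.1 hu.2.1
  rw [H1Rect.form_self] at h1
  have h3 := real_inner_le_norm w u.trTop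
  refine le_of_sq_le_mul_self (norm_nonneg _) (by positivity) ?_
  have h4 : P.κ * (‖u.dz‖ ^ 2 + ‖u.dr‖ ^ 2) + ‖u.trTop‖ ^ 2 = inner ℝ w u.trTop := by
    have := congrArg (P.κ * ·) h1
    simp only [mul_add, mul_inv_cancel_left₀ hκ.ne'] at this
    linarith
  rw [div_mul_eq_mul_div, div_mul_eq_mul_div, le_div_iff₀ (by positivity)]
  nlinarith [mul_le_mul_of_nonneg_left h3 hK.le, mul_le_mul_of_nonneg_left h2 hκ.le]

theorem H1Rect.norm_le_h1norm {L R : ℝ} (q : H1Rect L R) :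
    ‖q.val‖ ≤ q.h1norm ∧ ‖q.dz‖ ≤ q.h1norm ∧ ‖q.dr‖ ≤ q.h1norm := by
  have h1 := sq_nonneg ‖q.val‖
  have h2 := sq_nonneg ‖q.dz‖
  have h3 := sq_nonneg ‖q.dr‖
  refine ⟨Real.le_sqrt_of_sq_le ?_, Real.le_sqrt_of_sq_le ?_, Real.le_sqrt_of_sq_le ?_⟩ <;> linarith

theorem H1Rect.h1norm_le {L R : ℝ} (q : H1Rect L R) : q.h1norm ≤ ‖q.val‖ + ‖q.dz‖ + ‖q.dr‖ := by
  refine Real.sqrt_le_iff.2 ⟨by positivity, ?_⟩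
  nlinarith [mul_nonneg (norm_nonneg q.val) (norm_nonneg q.dz),
    mul_nonneg (norm_nonneg q.val) (norm_nonneg q.dr),
    mul_nonneg (norm_nonneg q.dz) (norm_nonneg q.dr)]

/-- Continuous dependence of the Robin solution on its data: the difference to a lift of the inlet
and outlet pressure is estimated by testing with itself. -/
theorem exists_robin_bound (P : TestProblem) : ∃ C : ℝ, 0 < C ∧
    ∀ (gIn gOut : L2Interval P.R) (w : L2Interval P.L) (M : ℝ) (u : H1Rect P.L P.R),
      InOutNormLE P.L P.R gIn gOut M → IsRobinSolution P.κ gIn gOut w u →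
      u.h1norm ≤ C * (‖w‖ + M) ∧ ‖u.trTop‖ ≤ C * (‖w‖ + M) := by
  obtain ⟨K, hK, hbd⟩ := H1Rect.exists_gradient_bound P.L_pos P.R_pos
  have hκ := P.κ_pos
  have hR := P.R_pos
  set b := (1 / P.R + 1) * √P.R with hb
  have hbpos : 0 < b := by positivity
  set A := P.κ⁻¹ * √K * (1 + 2 * b) + 2 with hA
  have hApos : 0 < A := by positivity
  refine ⟨(√K + 2) * A + 3 + 2 * b, by positivity, fun gIn gOut w M u hg hu => ?_⟩
  obtain ⟨q, hq0, hq1, hqM⟩ := hg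
  obtain ⟨n1, n2, n3⟩ := q.norm_le_h1norm
  have hM : 0 ≤ M := (norm_nonneg _).trans (n1.trans hqM)
  have hqT : ‖q.trTop‖ ≤ b * (2 * M) := by
    refine (q.norm_trTop_le hR).trans ?_
    gcongr
    linarith
  set v := H1Rect.lin 1 (-1) u q with hv
  have hv0 : v.trIn = 0 := by simp [hv, hq0, hu.1]
  have hv1 : v.trOut = 0 := by simp [hv, hq1, hu.2.1]
  obtain ⟨b1, b2, -⟩ := hbd v hv0 hv1
  set g := √(‖v.dz‖ ^ 2 + ‖v.dr‖ ^ 2) with hg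
  have hg2 : g ^ 2 = ‖v.dz‖ ^ 2 + ‖v.dr‖ ^ 2 := Real.sq_sqrt (by positivity)
  have hg0 : 0 ≤ g := Real.sqrt_nonneg _
  rw [← hg2] at b1 b2
  have toLe : ∀ t : ℝ, 0 ≤ t → t ^ 2 ≤ K * g ^ 2 → t ≤ √K * g := by
    intro t ht h
    refine abs_le_of_sq_le_sq' ?_ (by positivity) |>.2
    rwa [mul_pow, Real.sq_sqrt hK.le]
  have c1 := toLe _ (norm_nonneg _) b1
  have c2 := toLe _ (norm_nonneg _) b2
  have c3 : ‖v.dz‖ ≤ g := Real.le_sqrt_of_sq_le (by linarith [sq_nonneg ‖v.dr‖])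
  have c4 : ‖v.dr‖ ≤ g := Real.le_sqrt_of_sq_le (by linarith [sq_nonneg ‖v.dz‖])
  have hform : v.form P.κ⁻¹ v = P.κ⁻¹ * inner ℝ (w - q.trTop) v.trTop
      - inner ℝ q.dz v.dz - inner ℝ q.dr v.dr := by
    have h1 := (isRobinSolution_iff.1 hu).2.2 v hv0 hv1
    have h2 : v.form P.κ⁻¹ v = 1 * u.form P.κ⁻¹ v + (-1) * q.form P.κ⁻¹ v :=
      H1Rect.form_lin_left _ _ _ _ _ _
    rw [h2, h1, H1Rect.form, inner_sub_left]
    ring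
  have hgA : g ≤ A * (‖w‖ + M) := by
    refine le_of_sq_le_mul_self hg0 (by positivity) ?_
    have d1 : inner ℝ (w - q.trTop) v.trTop ≤ (‖w‖ + b * (2 * M)) * (√K * g) := by
      refine (real_inner_le_norm _ _).trans ?_
      gcongr
      exact (norm_sub_le _ _).trans (by linarith)
    have d2 : -inner ℝ q.dz v.dz ≤ M * g := by
      have h1 := abs_real_inner_le_norm q.dz v.dz
      have h2 := mul_le_mul (n2.trans hqM) c3 (norm_nonneg _) hM
      linarith [neg_abs_le (inner ℝ q.dz v.dz : ℝ)]
    have d3 : -inner ℝ q.dr v.dr ≤ M * g := by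
      have h1 := abs_real_inner_le_norm q.dr v.dr
      have h2 := mul_le_mul (n3.trans hqM) c4 (norm_nonneg _) hM
      linarith [neg_abs_le (inner ℝ q.dr v.dr : ℝ)]
    rw [H1Rect.form_self, ← hg2] at hform
    have d4 : 0 ≤ P.κ⁻¹ * ‖v.trTop‖ ^ 2 := by positivity
    have d5 := mul_le_mul_of_nonneg_left d1 (inv_nonneg.2 hκ.le)
    have d6 : P.κ⁻¹ * ((‖w‖ + b * (2 * M)) * (√K * g)) + M * g + M * g ≤ A * (‖w‖ + M) * g := by
      have e1 : 0 ≤ P.κ⁻¹ * √K * (2 * b) * ‖w‖ * g := by positivity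
      have e2 : 0 ≤ P.κ⁻¹ * √K * M * g := by positivity
      have e3 : 0 ≤ ‖w‖ * g := by positivity
      rw [hA]
      linarith
    linarith
  have s0 : 0 ≤ ‖w‖ + M := by positivity
  have tri : ∀ {X : Type} [NormedAddCommGroup X] [NormedSpace ℝ X] (x y : X),
      ‖x‖ ≤ ‖(1 : ℝ) • x + (-1 : ℝ) • y‖ + ‖y‖ := by
    intro X _ _ x y
    rw [one_smul, neg_one_smul, ← sub_eq_add_neg]
    linarith [norm_sub_norm_le x y]
  have t1 := tri u.val q.val
  have t2 := tri u.dz q.dz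
  have t3 := tri u.dr q.dr
  have t4 := tri u.trTop q.trTop
  rw [← H1Rect.lin_val, ← hv] at t1
  rw [← H1Rect.lin_dz, ← hv] at t2
  rw [← H1Rect.lin_dr, ← hv] at t3
  rw [← H1Rect.lin_trTop, ← hv] at t4
  have k1 : √K * g ≤ √K * (A * (‖w‖ + M)) := by gcongr
  have k2 : M ≤ ‖w‖ + M := le_add_of_nonneg_left (norm_nonneg _)
  have k3 := mul_le_mul_of_nonneg_left k2 hbpos.le
  have k4 : 0 ≤ A * (‖w‖ + M) := by positivity
  have k5 : 0 ≤ b * (‖w‖ + M) := by positivity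
  refine ⟨u.h1norm_le.trans ?_, ?_⟩
  · have : ‖u.val‖ + ‖u.dz‖ + ‖u.dr‖ ≤ √K * g + g + g + 3 * M := by linarith
    linarith
  · linarith

section
variable {P : TestProblem} {ρ C β dt M : ℝ} {pIn pOut : ℝ → L2Interval P.R}
  {p : ℕ → H1Rect P.L P.R}

theorem InOutNormLE.nonneg {L R M : ℝ} {gIn gOut : L2Interval R} (h : InOutNormLE L R gIn gOut M) :
    0 ≤ M := by
  obtain ⟨q, -, -, hq⟩ := h
  exact (Real.sqrt_nonneg _).trans hq

/-- With the contraction factor `ρ` and the bound `C` of the Robin problem, the initial pressure is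
forgotten geometrically. -/
theorem FluidSteps.norm_trTop_le (hρ0 : 0 ≤ ρ) (hρ1 : ρ < 1)
    (hρ : ∀ (w : L2Interval P.L) (u : H1Rect P.L P.R), IsRobinSolution P.κ 0 0 w u →
      ‖u.trTop‖ ≤ ρ * ‖w‖)
    (hC : ∀ (gIn gOut : L2Interval P.R) (w : L2Interval P.L) (M : ℝ) (u : H1Rect P.L P.R),
      InOutNormLE P.L P.R gIn gOut M → IsRobinSolution P.κ gIn gOut w u →
      u.h1norm ≤ C * (‖w‖ + M) ∧ ‖u.trTop‖ ≤ C * (‖w‖ + M))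
    (hC0 : 0 < C) (hβ0 : 0 ≤ β) (hβ1 : β ≤ 1) (hdt : 0 < dt)
    (hg : ∀ t, 0 ≤ t → InOutNormLE P.L P.R (pIn t) (pOut t) M)
    (hp : FluidSteps P β dt pIn pOut p) (n : ℕ) :
    ‖(p n).trTop‖ ≤ ρ ^ n * ‖(p 0).trTop‖ + C * M / (1 - ρ) := by
  have hM : 0 ≤ M := (hg 0 le_rfl).nonneg
  have h1 : 0 < 1 - ρ := by linarith
  induction n with
  | zero =>
    rw [pow_zero, one_mul]
    exact le_add_of_nonneg_right (by positivity)
  | succ n ih =>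
    have hgn := hg (((n : ℝ) + 1) * dt) (by positivity)
    obtain ⟨q, hq, -⟩ := existsUnique_isRobinSolution P 0 ⟨M, hgn⟩
    have hq2 := (hC _ _ _ _ _ hgn hq).2
    rw [norm_zero, zero_add] at hq2
    obtain ⟨S, hS⟩ := exists_isRobinTraceOperator P
    rw [hS.trTop_eq (hp n) hq]
    obtain ⟨v, hv, hSv⟩ := hS (β • (p n).trTop)
    have h2 := hρ _ _ hv
    rw [norm_smul, Real.norm_of_nonneg hβ0] at h2
    have h3 : ρ * (β * ‖(p n).trTop‖) ≤ ρ * (ρ ^ n * ‖(p 0).trTop‖ + C * M / (1 - ρ)) := by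
      gcongr
      exact (mul_le_of_le_one_left (norm_nonneg _) hβ1).trans ih
    have h4 : C * M / (1 - ρ) = C * M + ρ * (C * M / (1 - ρ)) := by
      field_simp; ring
    rw [hSv, pow_succ]
    linarith [norm_add_le q.trTop v.trTop]

/-- For inlet and outlet pressures that do not depend on time, the pressure on `Γ` converges
geometrically to the fixed point of the recursion. -/
theorem FluidSteps.exists_stationary (hρ0 : 0 ≤ ρ) (hρ1 : ρ < 1)
    (hρ : ∀ (w : L2Interval P.L) (u : H1Rect P.L P.R), IsRobinSolution P.κ 0 0 w u →
      ‖u.trTop‖ ≤ ρ * ‖w‖)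
    (hC : ∀ (gIn gOut : L2Interval P.R) (w : L2Interval P.L) (M : ℝ) (u : H1Rect P.L P.R),
      InOutNormLE P.L P.R gIn gOut M → IsRobinSolution P.κ gIn gOut w u →
      u.h1norm ≤ C * (‖w‖ + M) ∧ ‖u.trTop‖ ≤ C * (‖w‖ + M))
    (hβ0 : 0 ≤ β) (hβ1 : β ≤ 1) (hdt : 0 < dt)
    (hg : ∀ t, 0 ≤ t → InOutNormLE P.L P.R (pIn t) (pOut t) M)
    (hconst : ∀ t, 0 ≤ t → pIn t = pIn 0 ∧ pOut t = pOut 0)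
    (hp : FluidSteps P β dt pIn pOut p) :
    ∃ x : L2Interval P.L, ‖x‖ ≤ C * M / (1 - ρ) ∧
      ∀ n, ‖(p n).trTop - x‖ ≤ ρ ^ n * (‖(p 0).trTop‖ + C * M / (1 - ρ)) := by
  have hM : 0 ≤ M := (hg 0 le_rfl).nonneg
  have h1 : 0 < 1 - ρ := by linarith
  obtain ⟨S, hS⟩ := exists_isRobinTraceOperator P
  have hSρ : ∀ w, ‖S (β • w)‖ ≤ ρ * ‖w‖ := by
    intro w
    obtain ⟨v, hv, hSv⟩ := hS (β • w)
    rw [hSv]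
    refine (hρ _ _ hv).trans ?_
    rw [norm_smul, Real.norm_of_nonneg hβ0]
    gcongr
    exact mul_le_of_le_one_left (norm_nonneg _) hβ1
  obtain ⟨q, hq, -⟩ := existsUnique_isRobinSolution P 0 ⟨M, hg 0 le_rfl⟩
  have hq2 := (hC _ _ _ _ _ (hg 0 le_rfl) hq).2
  rw [norm_zero, zero_add] at hq2
  -- the fixed point exists because `1 - βS` is coercive
  obtain ⟨G, hG⟩ := exists_rightInverse_of_coercive
    (ContinuousLinearMap.id ℝ (L2Interval P.L) - β • S) h1 (fun v => by
      have h2 := (real_inner_le_norm (S (β • v)) v).trans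
        (mul_le_mul_of_nonneg_right (hSρ v) (norm_nonneg v))
      have h3 : (ContinuousLinearMap.id ℝ (L2Interval P.L) - β • S) v = v - S (β • v) := by
        rw [map_smul]; rfl
      rw [h3, inner_sub_left, real_inner_self_eq_norm_sq]
      linarith)
  set x := G q.trTop with hx
  have hfix : x = q.trTop + S (β • x) := by
    have h3 : (ContinuousLinearMap.id ℝ (L2Interval P.L) - β • S) x = x - S (β • x) := by
      rw [map_smul]; rfl
    have := hG q.trTop
    rw [← hx, h3] at this
    rw [← this]; abel
  have hxn : ‖x‖ ≤ C * M / (1 - ρ) := by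
    have h2 := norm_add_le q.trTop (S (β • x))
    rw [← hfix] at h2
    rw [le_div_iff₀ h1]
    linarith [hSρ x]
  refine ⟨x, hxn, fun n => ?_⟩
  induction n with
  | zero =>
    rw [pow_zero, one_mul]
    exact (norm_sub_le _ _).trans (by linarith)
  | succ n ih =>
    have hpn := hp n
    obtain ⟨c1, c2⟩ := hconst (((n : ℝ) + 1) * dt) (by positivity)
    rw [c1, c2] at hpn
    have h2 : (p (n + 1)).trTop - x = S (β • ((p n).trTop - x)) := by
      rw [smul_sub, map_sub, hS.trTop_eq hpn hq]
      nth_rewrite 1 [hfix]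
      abel
    rw [h2, pow_succ, mul_right_comm, mul_comm _ ρ]
    exact (hSρ _).trans (mul_le_mul_of_nonneg_left ih hρ0)

end

/-! ### Energy estimates for the `θ`-scheme -/

theorem sqrt_le_sqrt_add {E₀ E₁ g : ℝ} (hg : 0 ≤ g) (h0 : 0 ≤ E₀) (h1 : 0 ≤ E₁)
    (h : E₁ - E₀ ≤ g * (√E₁ + √E₀)) : √E₁ ≤ √E₀ + g := by
  have e0 := Real.sq_sqrt h0
  have e1 := Real.sq_sqrt h1
  have p0 := Real.sqrt_nonneg E₀
  have p1 := Real.sqrt_nonneg E₁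
  by_contra hlt
  push Not at hlt
  have : 0 < √E₁ + √E₀ := by linarith
  nlinarith

theorem le_add_sum_of_step {x f : ℕ → ℝ} {c : ℝ} (h : ∀ n, x (n + 1) ≤ x n + c * f n) (n : ℕ) :
    x n ≤ x 0 + c * ∑ k ∈ Finset.range n, f k := by
  induction n with
  | zero => simp
  | succ n ih =>
    rw [Finset.sum_range_succ, mul_add]
    linarith [h n]

theorem sum_le_of_geometric_bound {f : ℕ → ℝ} {ρ a b : ℝ} (hρ0 : 0 ≤ ρ) (hρ1 : ρ < 1) (ha : 0 ≤ a)
    (h : ∀ k, f k ≤ ρ ^ (k + 2) * a + b) (n : ℕ) :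
    ∑ k ∈ Finset.range n, f k ≤ (1 - ρ)⁻¹ * a + n * b := by
  have h1 : ∀ k ∈ Finset.range n, f k ≤ ρ ^ k * a + b := fun k _ =>
    (h k).trans (by
      gcongr ?_ * a + b
      exact pow_le_pow_of_le_one hρ0 hρ1.le (by lia))
  refine (Finset.sum_le_sum h1).trans ?_
  rw [Finset.sum_add_distrib, ← Finset.sum_mul, Finset.sum_const, Finset.card_range, nsmul_eq_mul]
  gcongr
  rw [← tsum_geometric_of_lt_one hρ0 hρ1]
  exact (summable_geometric_of_lt_one hρ0 hρ1).sum_le_tsum _ fun _ _ => by positivity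

section
variable {X : Type*} [NormedAddCommGroup X] [InnerProductSpace ℝ X]

theorem norm_sq_second_difference (t : ℝ) (a b e : X) :
    ‖t • (e - b)‖ ^ 2 - ‖t • (b - a)‖ ^ 2 = t ^ 2 * inner ℝ (e - (2 : ℝ) • b + a) (e - a) := by
  simp only [← real_inner_self_eq_norm_sq, inner_add_left, inner_sub_left, inner_sub_right,
    real_inner_smul_left, real_inner_smul_right, real_inner_comm a b, real_inner_comm a e,
    real_inner_comm b e]
  ring

theorem norm_sq_theta_average (θ : ℝ) (a b e : X) :
    (‖(1 / 2 : ℝ) • (b + e)‖ ^ 2 - ‖(1 / 2 : ℝ) • (a + b)‖ ^ 2)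
      + (θ - 1 / 4) * (‖e - b‖ ^ 2 - ‖b - a‖ ^ 2)
      = inner ℝ (θ • e + (1 - 2 * θ) • b + θ • a) (e - a) := by
  simp only [← real_inner_self_eq_norm_sq, inner_add_left, inner_sub_left, inner_sub_right,
    inner_add_right, real_inner_smul_left, real_inner_smul_right, real_inner_comm a b,
    real_inner_comm a e, real_inner_comm b e]
  ring

end

section
variable {P : TestProblem} {θ dt : ℝ}

/-- Discrete energy balance: testing with `η^{n+1} - η^{n-1}`. -/
theorem IsStructureStep.energy_sub {F : L2Interval P.L} {a b e : H10 P.L}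
    (h : IsStructureStep P θ dt F a b e) :
    energy P θ dt b e - energy P θ dt a b = inner ℝ F (e.val - a.val) := by
  have h1 := h (H10.lin 1 (-1) e a)
  simp only [H10.lin_val, H10.lin_dx, one_smul, neg_one_smul, ← sub_eq_add_neg] at h1
  have e1 := norm_sq_second_difference dt⁻¹ a.val b.val e.val
  have e2 := norm_sq_theta_average θ a.val b.val e.val
  have e3 := norm_sq_theta_average θ a.dx b.dx e.dx
  rw [energy, energy]
  linear_combination h1 + P.ρs * P.h * e1 + P.C₀ * e2 + P.C₁ * e3

theorem norm_sub_le_sqrt_energy (hθ : 1 / 4 ≤ θ) (hdt : 0 < dt) (a b : H10 P.L) :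
    0 ≤ energy P θ dt a b ∧
      ‖b.val - a.val‖ ≤ dt / √(P.ρs * P.h) * √(energy P θ dt a b) := by
  have h1 := mul_pos P.ρs_pos P.h_pos
  have h2 := P.C₀_pos
  have h3 := P.C₁_pos
  have h4 : 0 ≤ θ - 1 / 4 := by linarith
  have hE : P.ρs * P.h * ‖dt⁻¹ • (b.val - a.val)‖ ^ 2 ≤ energy P θ dt a b := by
    rw [energy, add_assoc]
    exact le_add_of_nonneg_right (by positivity)
  have h0 : 0 ≤ energy P θ dt a b := le_trans (by positivity) hE
  refine ⟨h0, ?_⟩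
  refine abs_le_of_sq_le_sq' ?_ (by positivity) |>.2
  rw [norm_smul, mul_pow, Real.norm_eq_abs, sq_abs] at hE
  rw [mul_pow, Real.sq_sqrt h0, div_pow, Real.sq_sqrt h1.le, div_mul_eq_mul_div,
    le_div_iff₀ h1]
  calc ‖b.val - a.val‖ ^ 2 * (P.ρs * P.h)
      = dt ^ 2 * (P.ρs * P.h * (dt⁻¹ ^ 2 * ‖b.val - a.val‖ ^ 2)) := by field_simp
    _ ≤ _ := by gcongr

theorem IsStructureStep.sqrt_energy_le (hθ : 1 / 4 ≤ θ) (hdt : 0 < dt) {F : L2Interval P.L}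
    {a b e : H10 P.L} (h : IsStructureStep P θ dt F a b e) :
    √(energy P θ dt b e) ≤ √(energy P θ dt a b) + dt / √(P.ρs * P.h) * ‖F‖ := by
  obtain ⟨p1, n1⟩ := norm_sub_le_sqrt_energy hθ hdt a b
  obtain ⟨p2, n2⟩ := norm_sub_le_sqrt_energy hθ hdt b e
  refine sqrt_le_sqrt_add (by positivity) p1 p2 ?_
  rw [h.energy_sub]
  have h1 : ‖e.val - a.val‖ ≤ ‖e.val - b.val‖ + ‖b.val - a.val‖ := by
    rw [← sub_add_sub_cancel e.val b.val a.val]; exact norm_add_le _ _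
  refine (real_inner_le_norm _ _).trans ?_
  have h2 := mul_le_mul_of_nonneg_left (h1.trans (add_le_add n2 n1)) (norm_nonneg F)
  linarith

/-- The elastic norm squared `C₀ ‖ξ‖² + C₁ ‖∂_z ξ‖²`. -/
def elasticSq (s : H10 P.L) : ℝ := P.C₀ * ‖s.val‖ ^ 2 + P.C₁ * ‖s.dx‖ ^ 2

theorem elasticSq_nonneg (s : H10 P.L) : 0 ≤ elasticSq s := by
  have h2 := P.C₀_pos
  have h3 := P.C₁_pos
  unfold elasticSq
  positivity

/-- A shift by a multiple `c s`, `c = ±1`, of a displacement that is constant in time changes the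
square root of the energy by at most the elastic norm of `s`. -/
theorem sqrt_energy_shift_le (hθ : 1 / 4 ≤ θ) (c : ℝ) (hc : c ^ 2 = 1) (a b s : H10 P.L) :
    √(energy P θ dt (H10.lin 1 c a s) (H10.lin 1 c b s)) ≤
      √(energy P θ dt a b) + √(elasticSq s) := by
  have h1 := mul_pos P.ρs_pos P.h_pos
  have h2 := P.C₀_pos
  have h3 := P.C₁_pos
  have h4 : 0 ≤ θ - 1 / 4 := by linarith
  have hc1 : |c| = 1 := by rw [← Real.sqrt_sq_eq_abs, hc, Real.sqrt_one]
  set x := (1 / 2 : ℝ) • (a.val + b.val) with hx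
  set y := (1 / 2 : ℝ) • (a.dx + b.dx) with hy
  have hE : P.C₀ * ‖x‖ ^ 2 + P.C₁ * ‖y‖ ^ 2 ≤ energy P θ dt a b := by
    rw [energy, ← hx, ← hy, add_assoc, add_left_comm]
    exact le_add_of_nonneg_right (by positivity)
  have h0 : 0 ≤ energy P θ dt a b := le_trans (by positivity) hE
  have hs := elasticSq_nonneg s
  have ev : (1 / 2 : ℝ) • ((a.val + c • s.val) + (b.val + c • s.val)) = x + c • s.val := by
    rw [hx]; module
  have ed : (1 / 2 : ℝ) • ((a.dx + c • s.dx) + (b.dx + c • s.dx)) = y + c • s.dx := by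
    rw [hy]; module
  have hexp : energy P θ dt (H10.lin 1 c a s) (H10.lin 1 c b s) = energy P θ dt a b
      + 2 * (c * (P.C₀ * inner ℝ x s.val + P.C₁ * inner ℝ y s.dx)) + elasticSq s := by
    simp only [energy, H10.lin_val, H10.lin_dx, one_smul, add_sub_add_right_eq_sub, ev, ed,
      norm_add_sq_real, real_inner_smul_right, norm_smul, Real.norm_eq_abs, hc1, elasticSq, ← hx,
      ← hy]
    ring
  have hcs : c * (P.C₀ * inner ℝ x s.val + P.C₁ * inner ℝ y s.dx) ≤
      √(energy P θ dt a b) * √(elasticSq s) := by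
    have i1 := abs_real_inner_le_norm x s.val
    have i2 := abs_real_inner_le_norm y s.dx
    have i3 : |c * (P.C₀ * inner ℝ x s.val + P.C₁ * inner ℝ y s.dx)| ≤
        P.C₀ * (‖x‖ * ‖s.val‖) + P.C₁ * (‖y‖ * ‖s.dx‖) := by
      rw [abs_mul, hc1, one_mul]
      refine (abs_add_le _ _).trans ?_
      rw [abs_mul, abs_mul, abs_of_pos h2, abs_of_pos h3]
      gcongr
    refine (le_abs_self _).trans (i3.trans ?_)
    rw [← Real.sqrt_mul h0]
    refine Real.le_sqrt_of_sq_le ?_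
    refine le_trans ?_ (mul_le_mul_of_nonneg_right hE hs)
    rw [elasticSq]
    nlinarith [mul_nonneg (mul_pos h2 h3).le (sq_nonneg (‖x‖ * ‖s.dx‖ - ‖y‖ * ‖s.val‖))]
  refine Real.sqrt_le_iff.2 ⟨by positivity, ?_⟩
  rw [hexp, add_sq, Real.sq_sqrt h0, Real.sq_sqrt hs]
  linarith

/-- The static displacement under a constant load `F`. -/
theorem exists_static (F : L2Interval P.L) : ∃ s : H10 P.L,
    (∀ ξ : H10 P.L, P.C₀ * inner ℝ s.val ξ.val + P.C₁ * inner ℝ s.dx ξ.dx = inner ℝ F ξ.val) ∧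
    √(elasticSq s) ≤ ‖F‖ / √P.C₀ := by
  have h2 := P.C₀_pos
  have h3 := P.C₁_pos
  obtain ⟨s, hs, -⟩ := H10.existsUnique_elliptic P.C₀_pos P.C₁_pos F 0
  simp only [inner_zero_left, add_zero] at hs
  refine ⟨s, hs, ?_⟩
  have h1 := hs s
  rw [real_inner_self_eq_norm_sq, real_inner_self_eq_norm_sq] at h1
  have h4 : √(elasticSq s) ^ 2 = elasticSq s := Real.sq_sqrt (elasticSq_nonneg s)
  have h5 : √P.C₀ * ‖s.val‖ ≤ √(elasticSq s) := by
    refine Real.le_sqrt_of_sq_le ?_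
    rw [mul_pow, Real.sq_sqrt h2.le, elasticSq]
    exact le_add_of_nonneg_right (by positivity)
  have h6 : 0 < √P.C₀ := Real.sqrt_pos.2 h2
  refine le_of_sq_le_mul_self (Real.sqrt_nonneg _) (by positivity) ?_
  rw [h4, div_mul_eq_mul_div, le_div_iff₀ h6]
  calc elasticSq s * √P.C₀ = inner ℝ F s.val * √P.C₀ := by rw [elasticSq, h1]
    _ ≤ ‖F‖ * ‖s.val‖ * √P.C₀ := by gcongr; exact real_inner_le_norm _ _
    _ = ‖F‖ * (√P.C₀ * ‖s.val‖) := by ring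
    _ ≤ _ := by gcongr

/-- The weights `θ`, `1 - 2θ`, `θ` add up to one and second differences of constants vanish, so a
static displacement can be subtracted together with its load. -/
theorem IsStructureStep.sub_static {F G : L2Interval P.L} {a b e s : H10 P.L}
    (h : IsStructureStep P θ dt F a b e)
    (hs : ∀ ξ : H10 P.L, P.C₀ * inner ℝ s.val ξ.val + P.C₁ * inner ℝ s.dx ξ.dx = inner ℝ G ξ.val) :
    IsStructureStep P θ dt (F - G) (H10.lin 1 (-1) a s) (H10.lin 1 (-1) b s)
      (H10.lin 1 (-1) e s) := by
  intro ξ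
  rw [inner_sub_left, ← h ξ, ← hs ξ]
  simp only [H10.lin_val, H10.lin_dx, inner_add_left, inner_sub_left, real_inner_smul_left]
  ring

/-- Modal energy balance, and coercivity of the modal energy with the factor
`σ = 1 - (1 - 4θ) l dt² / (4 ρs h)`. -/
theorem ModalSteps.sqrt_modalEnergy_le {l : ℝ} (hl : 0 ≤ l) (hdt : 0 < dt)
    (hσ : (1 - 4 * θ) * l * dt ^ 2 < 4 * (P.ρs * P.h)) {f y : ℕ → ℝ}
    (h : ModalSteps P θ dt l f y) :
    (∀ n, 0 ≤ modalEnergy P θ dt l (y n) (y (n + 1))) ∧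
    ∀ n, √(modalEnergy P θ dt l (y (n + 1)) (y (n + 2))) ≤
      √(modalEnergy P θ dt l (y n) (y (n + 1)))
      + dt / √(P.ρs * P.h) / √(1 - (1 - 4 * θ) * l * dt ^ 2 / (4 * (P.ρs * P.h)))
        * |f (n + 2)| := by
  have hm := mul_pos P.ρs_pos P.h_pos
  set m := P.ρs * P.h with hmdef
  set σ := 1 - (1 - 4 * θ) * l * dt ^ 2 / (4 * m) with hσdef
  have hσ0 : 0 < σ := by
    rw [hσdef, sub_pos, div_lt_one (by positivity)]; exact hσ
  have hEeq : ∀ a b, modalEnergy P θ dt l a b =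
      m * σ * ((b - a) / dt) ^ 2 + l * ((a + b) / 2) ^ 2 := by
    intro a b
    rw [modalEnergy, ← hmdef, hσdef]
    field_simp
    ring
  have hpos : ∀ a b, 0 ≤ modalEnergy P θ dt l a b := fun a b => by rw [hEeq]; positivity
  have hdiff : ∀ a b, |b - a| ≤ dt / √m / √σ * √(modalEnergy P θ dt l a b) := by
    intro a b
    refine abs_le_of_sq_le_sq ?_ (by positivity)
    rw [mul_pow, Real.sq_sqrt (hpos a b), div_pow, div_pow, Real.sq_sqrt hm.le, Real.sq_sqrt hσ0.le,
      div_div, div_mul_eq_mul_div, le_div_iff₀ (by positivity), hEeq]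
    have : (b - a) ^ 2 * (m * σ) = dt ^ 2 * (m * σ * ((b - a) / dt) ^ 2) := by field_simp
    rw [this]
    have h1 : 0 ≤ l * ((a + b) / 2) ^ 2 := by positivity
    gcongr
    linarith
  refine ⟨fun n => hpos _ _, fun n => ?_⟩
  refine sqrt_le_sqrt_add (by positivity) (hpos _ _) (hpos _ _) ?_
  have hbal : modalEnergy P θ dt l (y (n + 1)) (y (n + 2)) - modalEnergy P θ dt l (y n) (y (n + 1))
      = f (n + 2) * (y (n + 2) - y n) := by
    rw [← h n, modalEnergy, modalEnergy]
    field_simp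
    ring
  rw [hbal]
  have h1 := hdiff (y n) (y (n + 1))
  have h2 := hdiff (y (n + 1)) (y (n + 2))
  have h3 : |y (n + 2) - y n| ≤ |y (n + 2) - y (n + 1)| + |y (n + 1) - y n| := abs_sub_le _ _ _
  refine (le_abs_self _).trans ?_
  rw [abs_mul]
  have := mul_le_mul_of_nonneg_left (h3.trans (add_le_add h2 h1)) (abs_nonneg (f (n + 2)))
  linarith

end

/-! ### Stability with one constant -/

/-- The three stability estimates with one constant that depends on the test problem only. The
contraction factor `ρ` gives a geometric sum of the contributions of the initial pressure. -/
theorem exists_stability_constant (P : TestProblem) : ∃ C : ℝ, 0 < C ∧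
    ∀ (β dt : ℝ), 0 ≤ β → β ≤ 1 → 0 < dt →
    ∀ (pIn pOut : ℝ → L2Interval P.R) (M : ℝ),
    (∀ t, 0 ≤ t → InOutNormLE P.L P.R (pIn t) (pOut t) M) →
    ∀ p : ℕ → H1Rect P.L P.R, FluidSteps P β dt pIn pOut p →
    (∀ n : ℕ, (p (n + 1)).h1norm ≤ C * (‖(p 0).trTop‖ + M) ∧
      ‖(p (n + 1)).trTop‖ ≤ C * (‖(p 0).trTop‖ + M)) ∧
    (∀ θ : ℝ, 1 / 4 ≤ θ → ∀ η : ℕ → H10 P.L, StructureSteps P β θ dt p η →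
      (∀ n : ℕ, √(energy P θ dt (η n) (η (n + 1))) ≤ √(energy P θ dt (η 0) (η 1))
          + C * (dt * ‖(p 0).trTop‖ + (n * dt) * M)) ∧
      ((∀ t, 0 ≤ t → pIn t = pIn 0 ∧ pOut t = pOut 0) →
        ∀ n : ℕ, √(energy P θ dt (η n) (η (n + 1))) ≤ √(energy P θ dt (η 0) (η 1))
            + C * (dt * ‖(p 0).trTop‖ + (1 + dt) * M))) ∧
    (∀ θ : ℝ, ∀ j : ℕ, (1 - 4 * θ) * P.ell j * dt ^ 2 < 4 * (P.ρs * P.h) → ∀ y : ℕ → ℝ,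
      ModalSteps P θ dt (P.ell j) (fun n => β * inner ℝ (sineLp P.L j) (p n).trTop) y →
      ∀ n : ℕ, 0 ≤ modalEnergy P θ dt (P.ell j) (y n) (y (n + 1)) ∧
        √(modalEnergy P θ dt (P.ell j) (y n) (y (n + 1))) ≤
          √(modalEnergy P θ dt (P.ell j) (y 0) (y 1))
            + C / √(1 - (1 - 4 * θ) * P.ell j * dt ^ 2 / (4 * (P.ρs * P.h)))
              * (dt * ‖(p 0).trTop‖ + (n * dt) * M)) := by
  obtain ⟨ρ, hρ0, hρ1, hρ⟩ := exists_contraction_factor P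
  obtain ⟨C, hC0, hC⟩ := exists_robin_bound P
  have h1ρ : 0 < 1 - ρ := by linarith
  have hm := mul_pos P.ρs_pos P.h_pos
  have hC₀ := P.C₀_pos
  set D := (1 - ρ)⁻¹ with hD
  have hDpos : 0 < D := inv_pos.2 h1ρ
  set m := √(P.ρs * P.h) with hmdef
  have hmpos : 0 < m := Real.sqrt_pos.2 hm
  set c₀ := √P.C₀ with hc₀
  have hc₀pos : 0 < c₀ := Real.sqrt_pos.2 hC₀
  set K := 1 + C + C * D + C * (C * D) + D / m + C * D / m + 2 * (C * D) / c₀ + D * (C * D) / m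
    with hK
  have q1 : 0 < C * D := by positivity
  have q2 : 0 < C * (C * D) := by positivity
  have q3 : 0 < D / m := by positivity
  have q4 : 0 < C * D / m := by positivity
  have q5 : 0 < 2 * (C * D) / c₀ := by positivity
  have q6 : 0 < D * (C * D) / m := by positivity
  refine ⟨K, by positivity, fun β dt hβ0 hβ1 hdt pIn pOut M hg p hp => ?_⟩
  have hM : 0 ≤ M := (hg 0 le_rfl).nonneg
  set a := ‖(p 0).trTop‖ with ha
  have ha0 : 0 ≤ a := norm_nonneg _
  have htr : ∀ n, ‖(p n).trTop‖ ≤ ρ ^ n * a + C * D * M := fun n => by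
    have := hp.norm_trTop_le hρ0 hρ1 hρ hC hC0 hβ0 hβ1 hdt hg n
    rwa [div_eq_mul_inv, ← hD, mul_right_comm] at this
  have htr1 : ∀ n, ‖(p n).trTop‖ ≤ a + C * D * M := fun n =>
    (htr n).trans (by gcongr; exact mul_le_of_le_one_left ha0 (pow_le_one₀ hρ0 hρ1.le))
  have hβle : ∀ v : L2Interval P.L, ‖β • v‖ ≤ ‖v‖ := fun v => by
    rw [norm_smul, Real.norm_of_nonneg hβ0]
    exact mul_le_of_le_one_left (norm_nonneg _) hβ1
  have hload : ∀ n, ‖β • (p (n + 2)).trTop‖ ≤ ρ ^ (n + 2) * a + C * D * M := fun n =>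
    (hβle _).trans (htr _)
  have hsum : ∀ n : ℕ, dt / m * (D * a + n * (C * D * M)) ≤ K * (dt * a + (n * dt) * M) := by
    intro n
    have e : dt / m * (D * a + n * (C * D * M)) =
        D / m * (dt * a) + C * D / m * ((n * dt) * M) := by ring
    have k1 : D / m ≤ K := by rw [hK]; linarith
    have k2 : C * D / m ≤ K := by rw [hK]; linarith
    rw [e, mul_add]
    gcongr
  refine ⟨fun n => ?_, fun θ hθ η hη => ⟨fun n => ?_, fun hconst n => ?_⟩,
    fun θ j hσ y hy n => ?_⟩
  · obtain ⟨b1, -⟩ := hC _ _ _ _ _ (hg (((n : ℝ) + 1) * dt) (by positivity)) (hp n)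
    have b3 := mul_le_mul_of_nonneg_left ((hβle _).trans (htr1 n)) hC0.le
    have b4 := htr1 (n + 1)
    have k1 : C ≤ K := by rw [hK]; linarith
    have k2 : C + C * (C * D) ≤ K := by rw [hK]; linarith
    have k3 : 1 ≤ K := by rw [hK]; linarith
    have k4 : C * D ≤ K := by rw [hK]; linarith
    have l1 := mul_le_mul_of_nonneg_right k1 ha0
    have l2 := mul_le_mul_of_nonneg_right k2 hM
    have l3 := mul_le_mul_of_nonneg_right k3 ha0
    have l4 := mul_le_mul_of_nonneg_right k4 hM
    constructor <;> linarith
  · have hstep := le_add_sum_of_step (x := fun n => √(energy P θ dt (η n) (η (n + 1))))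
      (f := fun n => ‖β • (p (n + 2)).trTop‖)
      (fun n => (structureSteps_iff.1 hη n).sqrt_energy_le hθ hdt) n
    refine hstep.trans ?_
    have hs := mul_le_mul_of_nonneg_left (sum_le_of_geometric_bound hρ0 hρ1 ha0 hload n)
      (show 0 ≤ dt / m by positivity)
    have := hsum n
    simp only [zero_add]
    linarith
  · -- the static displacement under the limit load is subtracted, which leaves a summable load
    obtain ⟨x, hx, hpx⟩ := hp.exists_stationary hρ0 hρ1 hρ hC hβ0 hβ1 hdt hg hconst
    rw [div_eq_mul_inv, ← hD, mul_right_comm] at hx hpx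
    obtain ⟨s, hs, hsn⟩ := exists_static (β • x)
    set η' : ℕ → H10 P.L := fun n => H10.lin 1 (-1) (η n) s with hη'
    have hdiff : ∀ n, ‖β • (p (n + 2)).trTop - β • x‖ ≤ ρ ^ (n + 2) * (a + C * D * M) + 0 :=
      fun n => by
        rw [← smul_sub, add_zero]
        exact (hβle _).trans (hpx _)
    have hstep := le_add_sum_of_step (x := fun n => √(energy P θ dt (η' n) (η' (n + 1))))
      (f := fun n => ‖β • (p (n + 2)).trTop - β • x‖)
      (fun n => ((structureSteps_iff.1 hη n).sub_static hs).sqrt_energy_le hθ hdt) n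
    have hsb := mul_le_mul_of_nonneg_left
      (sum_le_of_geometric_bound hρ0 hρ1 (by positivity) hdiff n)
      (show 0 ≤ dt / m by positivity)
    have hback : ∀ k, H10.lin 1 1 (η' k) s = η k := fun k => by
      refine H10.ext ?_ ?_ <;> simp [hη']
    have g1 := sqrt_energy_shift_le (dt := dt) hθ 1 (by norm_num) (η' n) (η' (n + 1)) s
    rw [hback, hback] at g1
    have g2 := sqrt_energy_shift_le (dt := dt) hθ (-1) (by norm_num) (η 0) (η 1) s
    have g3 : √(elasticSq s) ≤ C * D * M / c₀ :=
      hsn.trans (div_le_div_of_nonneg_right ((hβle x).trans hx) hc₀pos.le)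
    have e : dt / m * (D * (a + C * D * M) + n * 0) =
        D / m * (dt * a) + D * (C * D) / m * (dt * M) := by ring
    have e2 : 2 * (C * D * M / c₀) = 2 * (C * D) / c₀ * M := by ring
    have k1 : D / m ≤ K := by rw [hK]; linarith
    have k2 : D * (C * D) / m ≤ K := by rw [hK]; linarith
    have k3 : 2 * (C * D) / c₀ ≤ K := by rw [hK]; linarith
    have l1 := mul_le_mul_of_nonneg_right k1 (show 0 ≤ dt * a by positivity)
    have l2 := mul_le_mul_of_nonneg_right k2 (show 0 ≤ dt * M by positivity)
    have l3 := mul_le_mul_of_nonneg_right k3 hM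
    simp only [zero_add] at hstep
    linarith
  · have hl : 0 ≤ P.ell j := by
      have := P.C₁_pos
      unfold TestProblem.ell
      positivity
    obtain ⟨hpos, hle⟩ := ModalSteps.sqrt_modalEnergy_le hl hdt hσ hy
    refine ⟨hpos n, ?_⟩
    set σ := √(1 - (1 - 4 * θ) * P.ell j * dt ^ 2 / (4 * (P.ρs * P.h))) with hσdef
    have hstep := le_add_sum_of_step
      (x := fun n => √(modalEnergy P θ dt (P.ell j) (y n) (y (n + 1))))
      (f := fun n => |β * inner ℝ (sineLp P.L j) (p (n + 2)).trTop|) hle n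
    have hf : ∀ n, |β * inner ℝ (sineLp P.L j) (p (n + 2)).trTop| ≤
        ρ ^ (n + 2) * a + C * D * M := fun n => by
      rw [← real_inner_smul_right]
      refine (abs_real_inner_le_norm _ _).trans ?_
      rw [(orthonormal_sineLp P.L_pos).1 j, one_mul]
      exact hload n
    refine hstep.trans ?_
    refine add_le_add le_rfl ?_
    refine (mul_le_mul_of_nonneg_left (sum_le_of_geometric_bound hρ0 hρ1 ha0 hf n)
      (show 0 ≤ dt / m / σ by positivity)).trans ?_
    calc dt / m / σ * (D * a + n * (C * D * M))
        = dt / m * (D * a + n * (C * D * M)) / σ := by ring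
      _ ≤ K * (dt * a + (n * dt) * M) / σ :=
        div_le_div_of_nonneg_right (hsum n) (Real.sqrt_nonneg _)
      _ = _ := by ring

end
theorem mainTheorem1 (P : TestProblem) :
    -- the Robin problem of the fluid step and the Neumann problem are well posed
    (∀ (gIn gOut : L2Interval P.R) (w : L2Interval P.L),
      (∃ M, InOutNormLE P.L P.R gIn gOut M) →
      ∃! u : H1Rect P.L P.R, IsRobinSolution P.κ gIn gOut w u) ∧
    (∀ w : L2Interval P.L, ∃! u : H1Rect P.L P.R, IsNeumannSolution w u) ∧
    -- the coupled scheme is well posed, for all time steps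
    (∀ (β θ dt : ℝ), 0 ≤ β → β ≤ 1 → 0 < θ → θ ≤ 1 / 2 → 0 < dt →
      ∀ (pIn pOut : ℝ → L2Interval P.R),
      (∀ t, 0 ≤ t → ∃ M, InOutNormLE P.L P.R (pIn t) (pOut t) M) →
      ∀ (p0 : H1Rect P.L P.R) (η0 η1 : H10 P.L),
      ∃! s : (ℕ → H1Rect P.L P.R) × (ℕ → H10 P.L),
        s.1 0 = p0 ∧ s.2 0 = η0 ∧ s.2 1 = η1 ∧
        FluidSteps P β dt pIn pOut s.1 ∧ StructureSteps P β θ dt s.1 s.2) ∧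
    ∃ (S M_A : L2Interval P.L →L[ℝ] L2Interval P.L) (z : HilbertBasis ℕ ℝ (L2Interval P.L)),
      IsRobinTraceOperator P S ∧ IsAddedMassOperator P M_A ∧
      -- spectral description of `S` and `M_A`
      (∀ j : ℕ, (z j : ℝ → ℝ) =ᵐ[volume.restrict (Ioo 0 P.L)]
        fun x => Real.sqrt (2 / P.L) * Real.sin (((j : ℝ) + 1) * Real.pi * x / P.L)) ∧
      (∀ j : ℕ, M_A (z j) = P.μ j • z j ∧ S (z j) = P.lam j • z j) ∧
      (∀ m : ℝ, Module.End.HasEigenvalue M_A.toLinearMap m ↔ ∃ j : ℕ, m = P.μ j) ∧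
      (∀ l : ℝ, Module.End.HasEigenvalue S.toLinearMap l ↔
        ∃ m : ℝ, Module.End.HasEigenvalue M_A.toLinearMap m ∧ l = m / (m + P.κ)) ∧
      (∀ l : ℝ, Module.End.HasEigenvalue S.toLinearMap l → 0 < l ∧ l ≤ P.lam 0 ∧ l < 1) ∧
      -- the pressure load on the string
      (∀ (β dt : ℝ), 0 ≤ β → β ≤ 1 → 0 < dt →
        ∀ (pIn pOut : ℝ → L2Interval P.R) (p q : ℕ → H1Rect P.L P.R),
        FluidSteps P β dt pIn pOut p → ExternalPressure P dt pIn pOut q →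
        (∀ n : ℕ, (p (n + 1)).trTop = (q (n + 1)).trTop + S (β • (p n).trTop)) ∧
        (∀ j n : ℕ, β * inner ℝ (z j) (p (n + 1)).trTop =
          (∑ i ∈ Finset.range (n + 1),
            β ^ (i + 1) * P.lam j ^ i * inner ℝ (z j) (q (n + 1 - i)).trTop)
          + β ^ (n + 2) * P.lam j ^ (n + 1) * inner ℝ (z j) (p 0).trTop) ∧
        (∀ j : ℕ, ∀ b : ℕ → ℝ, (∃ K, ∀ i, |b i| ≤ K) →
          Summable fun i : ℕ => β ^ (i + 1) * P.lam j ^ i * b i) ∧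
        (∀ j : ℕ, ∀ c : ℝ, Tendsto (fun n => inner ℝ (z j) (q n).trTop) atTop (𝓝 c) →
          Tendsto (fun n => β * inner ℝ (z j) (p n).trTop) atTop
            (𝓝 (∑' i : ℕ, β ^ (i + 1) * P.lam j ^ i * c)))) ∧
      -- the structure step decouples into modes
      (∀ (β θ dt : ℝ) (p : ℕ → H1Rect P.L P.R) (η : ℕ → H10 P.L),
        StructureSteps P β θ dt p η →
        ∀ j : ℕ, ModalSteps P θ dt (P.ell j) (fun n => β * inner ℝ (z j) (p n).trTop)
          (fun n => inner ℝ (z j) (η n).val)) ∧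
      -- stability, with one constant for all `β`, `θ`, time steps, numbers of steps and data
      ∃ C : ℝ, 0 < C ∧
        ∀ (β dt : ℝ), 0 ≤ β → β ≤ 1 → 0 < dt →
        ∀ (pIn pOut : ℝ → L2Interval P.R) (M : ℝ),
        (∀ t, 0 ≤ t → InOutNormLE P.L P.R (pIn t) (pOut t) M) →
        ∀ p : ℕ → H1Rect P.L P.R, FluidSteps P β dt pIn pOut p →
        -- pressure
        (∀ n : ℕ, (p (n + 1)).h1norm ≤ C * (‖(p 0).trTop‖ + M) ∧
          ‖(p (n + 1)).trTop‖ ≤ C * (‖(p 0).trTop‖ + M)) ∧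
        -- structure, every time step
        (∀ θ : ℝ, 1 / 4 ≤ θ → θ ≤ 1 / 2 → ∀ η : ℕ → H10 P.L, StructureSteps P β θ dt p η →
          (∀ n : ℕ, Real.sqrt (energy P θ dt (η n) (η (n + 1))) ≤
            Real.sqrt (energy P θ dt (η 0) (η 1))
              + C * (dt * ‖(p 0).trTop‖ + (n * dt) * M)) ∧
          ((∀ t, 0 ≤ t → pIn t = pIn 0 ∧ pOut t = pOut 0) →
            ∀ n : ℕ, Real.sqrt (energy P θ dt (η n) (η (n + 1))) ≤
              Real.sqrt (energy P θ dt (η 0) (η 1))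
                + C * (dt * ‖(p 0).trTop‖ + (1 + dt) * M))) ∧
        -- structure, mode by mode, on the whole range of `θ`
        (∀ θ : ℝ, 0 ≤ θ → θ ≤ 1 / 2 → ∀ j : ℕ,
          (1 - 4 * θ) * P.ell j * dt ^ 2 < 4 * (P.ρs * P.h) →
          ∀ y : ℕ → ℝ,
          ModalSteps P θ dt (P.ell j) (fun n => β * inner ℝ (z j) (p n).trTop) y →
          ∀ n : ℕ, 0 ≤ modalEnergy P θ dt (P.ell j) (y n) (y (n + 1)) ∧
            Real.sqrt (modalEnergy P θ dt (P.ell j) (y n) (y (n + 1))) ≤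
              Real.sqrt (modalEnergy P θ dt (P.ell j) (y 0) (y 1))
                + C / Real.sqrt (1 - (1 - 4 * θ) * P.ell j * dt ^ 2 / (4 * (P.ρs * P.h)))
                  * (dt * ‖(p 0).trTop‖ + (n * dt) * M)) := by
  obtain ⟨S, hS⟩ := exists_isRobinTraceOperator P
  obtain ⟨A, hA⟩ := exists_isAddedMassOperator P
  obtain ⟨C, hC, hstab⟩ := exists_stability_constant P
  have hz := sineBasis_apply P.L_pos
  have hSz : ∀ j, S (sineBasis P.L_pos j) = P.lam j • sineBasis P.L_pos j := fun j => by
    rw [hz, hS.apply_sineLp]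
  have hAz : ∀ j, A (sineBasis P.L_pos j) = P.μ j • sineBasis P.L_pos j := fun j => by
    rw [hz, hA.apply_sineLp]
  have eA := hasEigenvalue_iff_of_hilbertBasis (sineBasis P.L_pos) A hA.symmetric hAz
  have eS := hasEigenvalue_iff_of_hilbertBasis (sineBasis P.L_pos) S hS.symmetric hSz
  refine ⟨fun gIn gOut w h => existsUnique_isRobinSolution P w h,
    existsUnique_isNeumannSolution P,
    fun β θ dt _ _ hθ _ hdt pIn pOut h p0 η0 η1 => existsUnique_scheme P hθ hdt h p0 η0 η1,
    S, A, sineBasis P.L_pos, hS, hA, fun j => ?_, fun j => ⟨hAz j, hSz j⟩, eA, fun l => ?_,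
    fun l hl => ?_, ?_, ?_, C, hC, ?_⟩
  · rw [hz]
    filter_upwards [L2Interval.ofCont_ae (a := P.L) (continuous_sineMode P.L j)] with x hx
    rw [sineLp, hx, sineMode, freq, div_mul_eq_mul_div]
  · rw [eS]
    constructor
    · rintro ⟨j, rfl⟩
      exact ⟨P.μ j, (eA _).2 ⟨j, rfl⟩, rfl⟩
    · rintro ⟨m, hm, rfl⟩
      obtain ⟨j, rfl⟩ := (eA m).1 hm
      exact ⟨j, rfl⟩
  · obtain ⟨j, rfl⟩ := (eS l).1 hl
    exact ⟨P.lam_pos j, P.lam_le j, P.lam_lt_one j⟩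
  · intro β dt hβ0 hβ1 hdt pIn pOut p q hp hq
    have hrec : ∀ n, (p (n + 1)).trTop = (q (n + 1)).trTop + S (β • (p n).trTop) :=
      fun n => hS.trTop_eq (hp n) (hq n)
    have hmode : ∀ j n, (inner ℝ (sineBasis P.L_pos j) (p (n + 1)).trTop : ℝ) =
        inner ℝ (sineBasis P.L_pos j) (q (n + 1)).trTop
          + P.lam j * (β * inner ℝ (sineBasis P.L_pos j) (p n).trTop) := fun j n => by
      rw [hrec, inner_add_right, ← hS.symmetric, hSz, real_inner_smul_left, real_inner_smul_right]
    exact ⟨hrec, fun j n => eq_sum_of_linear_recursion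
        (x := fun n => inner ℝ (sineBasis P.L_pos j) (p n).trTop)
        (y := fun n => inner ℝ (sineBasis P.L_pos j) (q n).trTop) (hmode j) n,
      fun j b ⟨K, hK⟩ => summable_geometric_mul_bounded hβ0 hβ1 (P.lam_pos j).le
        (P.lam_lt_one j) hK,
      fun j c hc => tendsto_of_linear_recursion
        (x := fun n => inner ℝ (sineBasis P.L_pos j) (p n).trTop) hβ0 hβ1 (P.lam_pos j).le
        (P.lam_lt_one j) (hmode j) hc⟩
  · intro β θ dt p η hη j
    rw [hz]
    exact hη.modalSteps j
  · intro β dt hβ0 hβ1 hdt pIn pOut M hg p hp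
    obtain ⟨h1, h2, h3⟩ := hstab β dt hβ0 hβ1 hdt pIn pOut M hg p hp
    refine ⟨h1, fun θ hθ _ η hη => h2 θ hθ η hη, fun θ _ _ j hσ y hy => h3 θ j hσ y ?_⟩
    rw [hz] at hy
    exact hy
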